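/- Let $\Gamma$ be a compact connected metric graph, i.e. a connected graph with finitely many vertices $V(\Gamma)$ and edges $E(\Gamma)$ (loops and parallel edges are allowed), in which each edge $e$ is identified with an interval $[0,\ell_e]$, $0<\ell_e<\infty$. Call a vertex $v$ terminal if there is exactly one vertex adjacent to $v$ (a vertex with a loop is adjacent to itself). Let $1<p<\infty$ and let $V_D$ be a non-empty set of terminal vertices of $\Gamma$; if $V_D=V(\Gamma)$, assume moreover that $\Gamma$ has only one edge. Let $\mathcal X(\Gamma,V_D)$ be the set of continuous functions $u$ on $\Gamma$ that vanish on $V_D$ and whose restriction to each edge $e$ belongs to $W^{1,p}(0,\ell_e)$, and put $$\lambda_{1,p}(\Gamma,V_D)=\inf\left\{\frac{\int_\Gamma|u'|^p\,dx}{\int_\Gamma|u|^p\,dx}\colon u\in\mathcal X(\Gamma,V_D),\ u\neq0\right\}.$$ An eigenfunction associated to $\lambda\in\mathbb R$ is a function $u\in\mathcal X(\Gamma,V_D)$, $u\ne0$, such that $$\int_\Gamma|u'|^{p-2}u'w'\,dx=\lambda\int_\Gamma|u|^{p-2}u\,w\,dx\qquad\text{for all }w\in\mathcal X(\Gamma,V_D).$$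 Then every eigenfunction $u$ associated to $\lambda_{1,p}(\Gamma,V_D)$ has a strict sign: either $u>0$ on $\Gamma\setminus V_D$ or $u<0$ on $\Gamma\setminus V_D$. Moreover, $\lambda_{1,p}(\Gamma,V_D)$ is a simple eigenvalue: it has an eigenfunction, and any two eigenfunctions associated to it are nonzero scalar multiples of each other. -/

import Mathlib

open Set MeasureTheory
open scoped ContDiff

/-- `g` is the weak derivative of `f` on the interval `(0, l)`: both are locally integrable there,
and `∫ f φ' = -∫ g φ` for every smooth `φ` with compact support in `(0, l)`. -/
def HasWeakDerivOn (l : ℝ) (f g : ℝ → ℝ) : Prop :=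
  LocallyIntegrableOn f (Ioo 0 l) volume ∧ LocallyIntegrableOn g (Ioo 0 l) volume ∧
    ∀ φ : ℝ → ℝ, ContDiff ℝ ∞ φ → HasCompactSupport φ → tsupport φ ⊆ Ioo 0 l →
      ∫ x in Ioo 0 l, f x * deriv φ x = - ∫ x in Ioo 0 l, g x * φ x

open Classical in
/-- The weak derivative of `f` on `(0, l)` (determined almost everywhere on `(0, l)`);
it is `0` if `f` has no weak derivative. -/
noncomputable def weakDerivOn (l : ℝ) (f : ℝ → ℝ) : ℝ → ℝ :=
  if h : ∃ g, HasWeakDerivOn l f g then h.choose else 0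

/-- The Sobolev space `W^{1,p}(0, l)`. -/
def MemW1p (p l : ℝ) (f : ℝ → ℝ) : Prop :=
  MemLp f (ENNReal.ofReal p) (volume.restrict (Ioo 0 l)) ∧
    ∃ g, HasWeakDerivOn l f g ∧ MemLp g (ENNReal.ofReal p) (volume.restrict (Ioo 0 l))

/-- A metric graph with vertex set `V` and edge set `E`, all of whose edges have finite length.
Loops and parallel edges are allowed. Every edge `e` is given an orientation, and is
identified with `[0, length e]` through a coordinate that is `0` at the vertex `init e` and
`length e` at the vertex `term e`. The graph is compact when `V` and `E` are finite. -/
structure MetricGraph (V E : Type*) where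
  init : E → V
  term : E → V
  length : E → ℝ
  length_pos : ∀ e, 0 < length e

namespace MetricGraph

/-- Two vertices are adjacent if some edge connects them (a loop makes its vertex adjacent
to itself). -/
def Adj {V E : Type*} (Γ : MetricGraph V E) (a b : V) : Prop :=
  ∃ e, (Γ.init e = a ∧ Γ.term e = b) ∨ (Γ.init e = b ∧ Γ.term e = a)

/-- Any two vertices are joined by a finite chain of edges. -/
def Connected {V E : Type*} (Γ : MetricGraph V E) : Prop :=
  ∀ a b : V, Relation.ReflTransGen Γ.Adj a b

/-- A terminal vertex: there is exactly one vertex adjacent to it. -/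
def IsTerminal {V E : Type*} (Γ : MetricGraph V E) (v : V) : Prop :=
  ∃! a : V, Γ.Adj a v

/-- The point with coordinate `x` on the edge `e` is a vertex that belongs to `S`. -/
def IsVertexIn {V E : Type*} (Γ : MetricGraph V E) (S : Set V) (e : E) (x : ℝ) : Prop :=
  (x = 0 ∧ Γ.init e ∈ S) ∨ (x = Γ.length e ∧ Γ.term e ∈ S)

/-- A function on the graph is a family of functions `u e` on the edges; only the values of `u e`
on `[0, length e]` matter. It is continuous on the graph if every `u e` is continuous on
`[0, length e]` and at each vertex all the incident edges give the same value. -/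
def IsContinuous {V E : Type*} (Γ : MetricGraph V E) (u : E → ℝ → ℝ) : Prop :=
  (∀ e, ContinuousOn (u e) (Icc 0 (Γ.length e))) ∧
    ∃ f : V → ℝ, ∀ e, u e 0 = f (Γ.init e) ∧ u e (Γ.length e) = f (Γ.term e)

/-- The space `X(Γ, V_D)` of the functions in `W^{1,p}(Γ)` (continuous on the graph by definition)
that vanish at the vertices in `VD`. -/
def MemX {V E : Type*} (Γ : MetricGraph V E) (p : ℝ) (VD : Set V) (u : E → ℝ → ℝ) : Prop :=
  Γ.IsContinuous u ∧ (∀ e, MemW1p p (Γ.length e) (u e)) ∧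
    ∀ e, ∀ x ∈ Icc 0 (Γ.length e), Γ.IsVertexIn VD e x → u e x = 0

/-- `u` is not the zero function on the graph. -/
def IsNontrivial {V E : Type*} (Γ : MetricGraph V E) (u : E → ℝ → ℝ) : Prop :=
  ∃ e, ∃ x ∈ Icc 0 (Γ.length e), u e x ≠ 0

/-- The derivative of `u` along the edges. -/
noncomputable def edgeDeriv {V E : Type*} (Γ : MetricGraph V E) (u : E → ℝ → ℝ) : E → ℝ → ℝ :=
  fun e => weakDerivOn (Γ.length e) (u e)

/-- The integral of `f` over the graph. -/
noncomputable def integral {V E : Type*} [Fintype E] (Γ : MetricGraph V E) (f : E → ℝ → ℝ) : ℝ :=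
  ∑ e, ∫ x in Ioo 0 (Γ.length e), f e x

/-- `λ_{1,p}(Γ, V_D)`: the infimum of `∫ |u'|^p / ∫ |u|^p` over the nonzero `u` in `X(Γ, V_D)`. -/
noncomputable def firstEigenvalue {V E : Type*} [Fintype E] (Γ : MetricGraph V E) (p : ℝ)
    (VD : Set V) : ℝ :=
  sInf {r : ℝ | ∃ u : E → ℝ → ℝ, Γ.MemX p VD u ∧ Γ.IsNontrivial u ∧
    r = Γ.integral (fun e x => |Γ.edgeDeriv u e x| ^ p) / Γ.integral (fun e x => |u e x| ^ p)}

/-- `u` is an eigenfunction of the `p`-Laplacian associated to `lam`: a nonzero weak solution, in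
`X(Γ, V_D)`, of `-(|u'|^{p-2} u')' = lam |u|^{p-2} u`, tested against all of `X(Γ, V_D)`. -/
def IsEigenfunction {V E : Type*} [Fintype E] (Γ : MetricGraph V E) (p : ℝ) (VD : Set V)
    (lam : ℝ) (u : E → ℝ → ℝ) : Prop :=
  Γ.MemX p VD u ∧ Γ.IsNontrivial u ∧
    ∀ w : E → ℝ → ℝ, Γ.MemX p VD w →
      Γ.integral (fun e x =>
          |Γ.edgeDeriv u e x| ^ (p - 2) * Γ.edgeDeriv u e x * Γ.edgeDeriv w e x) =
        lam * Γ.integral (fun e x => |u e x| ^ (p - 2) * u e x * w e x)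

/-- `lam` is a simple eigenvalue: it is an eigenvalue, and any two eigenfunctions associated to it
are multiples of each other. -/
def IsSimpleEigenvalue {V E : Type*} [Fintype E] (Γ : MetricGraph V E) (p : ℝ) (VD : Set V)
    (lam : ℝ) : Prop :=
  (∃ u : E → ℝ → ℝ, Γ.IsEigenfunction p VD lam u) ∧
    ∀ u v : E → ℝ → ℝ, Γ.IsEigenfunction p VD lam u → Γ.IsEigenfunction p VD lam v →
      ∃ c : ℝ, c ≠ 0 ∧ ∀ e, ∀ x ∈ Icc 0 (Γ.length e), v e x = c * u e x

end MetricGraph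

/-! Write E(u) for the integral of |u'|^p and N(u) for that of |u|^p. Everything rests on the fact
that first eigenfunctions are exactly the nonzero minimizers of E/N: testing the equation with u
gives E(u) = λ₁ N(u), and conversely t ↦ E(u+tw) - λ₁ N(u+tw) is nonnegative and vanishes at 0, so
its derivative there is zero (`IsGPrim.isEigenfunction`).

Existence uses no weak topology. A minimizing sequence of supremum norm 1 is equicontinuous, hence
has a uniformly convergent subsequence (`exists_uniform_subseq`). Midpoints of its members cannot
have energy much below λ₁ N, so the quantitative strict convexity of |·|^p
(`exists_abs_sub_rpow_le`) makes the derivatives Cauchy in L^p.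

Sign. On an edge the flux |u'|^{p-2}u' is C - λ∫|u|^{p-2}u, and fluxes balance at vertices outside
V_D (`IsEigenfunction.exists_flux`). For u ≥ 0 and λ ≥ 0 the flux is nonincreasing, so u vanishes on
any edge where u and its flux have a common zero. The flux is zero at an interior zero of u. At a
zero vertex outside V_D all outgoing fluxes are nonnegative and sum to zero, so each is zero and u
vanishes on all incident edges. Terminal vertices never separate edges, so the zero spreads to the
whole graph (`forall_edge_of_exists`). Apply this to |u|, again a minimizer.

Simplicity. Let u, v be positive minimizers and c u(x) = v(x) at an interior point x of an edge.
Since E and N are additive over max and min, max(cu, v) is a minimizer, hence an eigenfunction,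
hence differentiable at x. A corner is excluded, so c u'(x) = v'(x) and (v/u)'(x) = 0. Thus v/u is
constant on each edge, and continuity at the vertices makes the constants agree. -/

/-! ### Test functions and the du Bois-Reymond lemma. -/

theorem setIntegral_Ioo_eq_intervalIntegral {l : ℝ} (hl : 0 ≤ l) (f : ℝ → ℝ) :
    ∫ x in Ioo 0 l, f x = ∫ x in (0 : ℝ)..l, f x := by
  rw [intervalIntegral.integral_of_le hl, integral_Ioc_eq_integral_Ioo]

/-- Integration by parts for a primitive of an integrable function against a test function. -/
theorem integral_primitive_mul_deriv {l : ℝ} (hl : 0 ≤ l) {k φ : ℝ → ℝ}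
    (hk : IntervalIntegrable k volume 0 l) (hφ : ContDiff ℝ ∞ φ) (hsupp : tsupport φ ⊆ Ioo 0 l) :
    ∫ x in Ioo 0 l, (∫ t in (0 : ℝ)..x, k t) * deriv φ x = - ∫ x in Ioo 0 l, k x * φ x := by
  rw [setIntegral_Ioo_eq_intervalIntegral hl, setIntegral_Ioo_eq_intervalIntegral hl]
  have hK : AbsolutelyContinuousOnInterval (fun x => ∫ t in (0 : ℝ)..x, k t) 0 l :=
    hk.absolutelyContinuousOnInterval_intervalIntegral (by simp)
  have hφ' : AbsolutelyContinuousOnInterval φ 0 l :=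
    (hφ.contDiffOn.of_le (by simp)).absolutelyContinuousOnInterval
  have h0 : φ 0 = 0 := image_eq_zero_of_notMem_tsupport fun h => by simpa using hsupp h
  have h1 : φ l = 0 := image_eq_zero_of_notMem_tsupport fun h => by simpa using hsupp h
  rw [hK.integral_mul_deriv_eq_deriv_mul hφ', h0, h1]
  simp only [mul_zero, sub_zero, zero_sub, neg_inj]
  apply intervalIntegral.integral_congr_ae
  filter_upwards [hk.ae_hasDerivAt_integral] with x hx hx'
  rw [(hx (uIoc_subset_uIcc hx') 0 (by simp)).deriv]

/-- The du Bois-Reymond lemma: a function whose weak derivative vanishes is constant. -/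
theorem ae_const_of_integral_mul_deriv_eq_zero {l : ℝ} (hl : 0 < l) {h : ℝ → ℝ}
    (hh : LocallyIntegrableOn h (Ioo 0 l) volume)
    (H : ∀ φ : ℝ → ℝ, ContDiff ℝ ∞ φ → HasCompactSupport φ → tsupport φ ⊆ Ioo 0 l →
      ∫ x in Ioo 0 l, h x * deriv φ x = 0) :
    ∃ c, ∀ᵐ x ∂volume.restrict (Ioo 0 l), h x = c := by
  -- A bump supported in [l/4, 3l/4]; normalized to integral 1, it serves to remove the mean of a
  -- test function.
  let b : ContDiffBump (l / 2) := ⟨l / 8, l / 4, by positivity, by linarith⟩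
  let ψ₀ : ℝ → ℝ := b.normed volume
  have hb1 : ∫ x, ψ₀ x = 1 := b.integral_normed
  have hbC : HasCompactSupport ψ₀ := b.hasCompactSupport_normed
  have hbS : tsupport ψ₀ ⊆ Ioo 0 l := by
    rw [b.tsupport_normed_eq, Real.closedBall_eq_Icc]
    intro x hx
    simp only [mem_Icc, b] at hx
    constructor <;> linarith [hx.1, hx.2]
  have hbD : ContDiff ℝ ∞ ψ₀ := b.contDiff_normed
  have key : ∀ ψ : ℝ → ℝ, Continuous ψ → HasCompactSupport ψ → tsupport ψ ⊆ Ioo 0 l →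
      Integrable (fun x => ψ x * h x) := by
    intro ψ h1 h2 h3
    have hi : IntegrableOn h (tsupport ψ) := hh.integrableOn_compact_subset h3 h2
    have : IntegrableOn (fun x => ψ x * h x) (tsupport ψ) :=
      hi.continuousOn_mul h1.continuousOn h2
    rwa [integrableOn_iff_integrable_of_support_subset] at this
    exact (Function.support_mul_subset_left _ _).trans (subset_tsupport _)
  have restr : ∀ f ψ : ℝ → ℝ, tsupport ψ ⊆ Ioo 0 l →
      ∫ x in Ioo 0 l, f x * ψ x = ∫ x, ψ x * f x := by
    intro f ψ h3
    rw [setIntegral_eq_integral_of_forall_compl_eq_zero]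
    · simp_rw [mul_comm]
    · intro x hx
      rw [image_eq_zero_of_notMem_tsupport fun h => hx (h3 h), mul_zero]
  refine ⟨∫ x, ψ₀ x * h x, ?_⟩
  set c := ∫ x, ψ₀ x * h x with hc
  rw [ae_restrict_iff' measurableSet_Ioo]
  have := isOpen_Ioo.ae_eq_zero_of_integral_contDiff_smul_eq_zero (μ := volume)
    (f := fun x => h x - c) (U := Ioo 0 l) (hh.sub (locallyIntegrableOn_const _)) ?_
  · filter_upwards [this] with x hx hx'
    linarith [hx hx']
  intro ψ hψ hψC hψS
  set m := ∫ x, ψ x with hm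
  -- η has mean zero, so its primitive again has compact support in (0, l) and is an admissible test
  -- function in `H`.
  let η : ℝ → ℝ := fun x => ψ x - m * ψ₀ x
  have hψi : Integrable ψ := hψ.continuous.integrable_of_hasCompactSupport hψC
  have hψ0i : Integrable ψ₀ := hbD.continuous.integrable_of_hasCompactSupport hbC
  have hηD : ContDiff ℝ ∞ η := hψ.sub (contDiff_const.mul hbD)
  have hηi : Integrable η := hψi.sub (hψ0i.const_mul m)
  have hη0 : ∫ x, η x = 0 := by
    rw [integral_sub hψi (hψ0i.const_mul m), integral_const_mul, hb1]; simp [hm]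
  have hT : IsCompact (tsupport ψ ∪ tsupport ψ₀) := IsCompact.union hψC hbC
  have hTS : tsupport ψ ∪ tsupport ψ₀ ⊆ Ioo 0 l := union_subset hψS hbS
  have hTn : (tsupport ψ ∪ tsupport ψ₀).Nonempty := by
    refine Nonempty.inr ?_
    rw [b.tsupport_normed_eq]
    exact ⟨l / 2, Metric.mem_closedBall_self b.rOut_pos.le⟩
  obtain ⟨a₁, ha₁, hmin⟩ := hT.exists_isMinOn hTn continuousOn_id
  obtain ⟨a₂, ha₂, hmax⟩ := hT.exists_isMaxOn hTn continuousOn_id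
  have hηz : ∀ x, (x < a₁ ∨ a₂ < x) → η x = 0 := by
    intro x hx
    have hxn : x ∉ tsupport ψ ∪ tsupport ψ₀ := by
      intro hx'
      have h1 := hmin hx'
      have h2 := hmax hx'
      simp only [id, mem_ofPred_eq] at h1 h2
      rcases hx with h | h <;> linarith
    rw [mem_union, not_or] at hxn
    simp [η, image_eq_zero_of_notMem_tsupport hxn.1, image_eq_zero_of_notMem_tsupport hxn.2]
  let Φ : ℝ → ℝ := fun x => ∫ t in (0 : ℝ)..x, η t
  have hΦd : ∀ x, HasDerivAt Φ (η x) x := fun x =>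
    intervalIntegral.integral_hasDerivAt_right hηi.intervalIntegrable
      hηD.continuous.stronglyMeasurable.stronglyMeasurableAtFilter hηD.continuous.continuousAt
  have hΦd' : deriv Φ = η := funext fun x => (hΦd x).deriv
  have hΦD : ContDiff ℝ ∞ Φ := by
    rw [contDiff_infty_iff_deriv]
    exact ⟨fun x => (hΦd x).differentiableAt, hΦd' ▸ hηD⟩
  have hΦz : ∀ x, x ∉ Icc a₁ a₂ → Φ x = 0 := by
    intro x hx
    rw [mem_Icc, not_and_or, not_le, not_le] at hx
    rcases hx with hx | hx
    · have : Φ x = ∫ t in (0 : ℝ)..x, (0 : ℝ) := by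
        apply intervalIntegral.integral_congr
        intro t ht
        apply hηz
        left
        have := (hTS ha₁).1
        rcases le_total 0 x with h | h
        · rw [uIcc_of_le h] at ht; exact ht.2.trans_lt hx
        · rw [uIcc_of_ge h] at ht; exact ht.2.trans_lt this
      simpa using this
    · have h0 : (0 : ℝ) < a₁ := (hTS ha₁).1
      have h1 : a₁ ≤ a₂ := hmin ha₂
      have : Φ x = ∫ t, η t := by
        simp only [Φ]
        rw [intervalIntegral.integral_of_le (by linarith)]
        apply setIntegral_eq_integral_of_forall_compl_eq_zero
        intro t ht
        apply hηz
        rw [mem_Ioc, not_and_or, not_lt, not_le] at ht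
        rcases ht with h | h
        · left; linarith
        · right; linarith
      rw [this, hη0]
  have hΦt : tsupport Φ ⊆ Icc a₁ a₂ := by
    apply closure_minimal _ isClosed_Icc
    intro x hx
    by_contra h
    exact hx (hΦz x h)
  have hΦC : HasCompactSupport Φ := HasCompactSupport.of_support_subset_isCompact isCompact_Icc
    ((subset_tsupport _).trans hΦt)
  have hΦS : tsupport Φ ⊆ Ioo 0 l := hΦt.trans fun x hx =>
    ⟨(hTS ha₁).1.trans_le hx.1, hx.2.trans_lt (hTS ha₂).2⟩
  have h0 := H Φ hΦD hΦC hΦS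
  rw [hΦd', restr h η] at h0
  · have i1 := key ψ hψ.continuous hψC hψS
    have i2 := key ψ₀ hbD.continuous hbC hbS
    have e1 : ∫ x, η x * h x = (∫ x, ψ x * h x) - m * c := by
      rw [hc, ← integral_const_mul, ← integral_sub i1 (i2.const_mul m)]
      congr 1; ext x; simp only [η]; ring
    have e2 : ∫ x, ψ x • (h x - c) = (∫ x, ψ x * h x) - m * c := by
      rw [hm, ← integral_mul_const, ← integral_sub i1 (hψi.mul_const c)]
      congr 1; ext x; simp only [smul_eq_mul]; ring
    rw [e2, ← e1, h0]
  · rw [← hΦd']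
    exact (tsupport_deriv_subset).trans hΦS

/-! ### Sobolev functions on an interval as primitives. -/

/-- `u` is, on `[0, l]`, a primitive of the `L^p` function `g`. -/
def IsPrim (p l : ℝ) (u g : ℝ → ℝ) : Prop :=
  MemLp g (ENNReal.ofReal p) (volume.restrict (Ioo 0 l)) ∧
    ∀ x ∈ Icc 0 l, u x = u 0 + ∫ t in (0 : ℝ)..x, g t

theorem MeasureTheory.MemLp.integrableOn_Ioo {p l : ℝ} (hp : 1 < p) {g : ℝ → ℝ}
    (hg : MemLp g (ENNReal.ofReal p) (volume.restrict (Ioo 0 l))) :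
    IntegrableOn g (Ioo 0 l) :=
  hg.integrable (by rw [ENNReal.one_le_ofReal]; exact hp.le)

theorem MeasureTheory.MemLp.intervalIntegrable_Ioo {p l : ℝ} (hp : 1 < p) (hl : 0 ≤ l) {g : ℝ → ℝ}
    (hg : MemLp g (ENNReal.ofReal p) (volume.restrict (Ioo 0 l))) :
    IntervalIntegrable g volume 0 l :=
  (intervalIntegrable_iff_integrableOn_Ioo_of_le hl).2 (hg.integrableOn_Ioo hp)

theorem ContinuousOn.memLp_Ioo {l : ℝ} {q : ENNReal} {f : ℝ → ℝ}
    (hf : ContinuousOn f (Icc 0 l)) : MemLp f q (volume.restrict (Ioo 0 l)) := by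
  obtain ⟨C, hC⟩ := isCompact_Icc.exists_bound_of_continuousOn hf
  refine MemLp.of_bound ((hf.mono Ioo_subset_Icc_self).aestronglyMeasurable measurableSet_Ioo) C ?_
  filter_upwards [ae_restrict_mem measurableSet_Ioo] with x hx
  exact hC x (Ioo_subset_Icc_self hx)

theorem eqOn_Icc_of_ae_eq {l : ℝ} (hl : 0 < l) {f g : ℝ → ℝ} (hf : ContinuousOn f (Icc 0 l))
    (hg : ContinuousOn g (Icc 0 l)) (h : ∀ᵐ x ∂volume.restrict (Ioo 0 l), f x = g x) :
    EqOn f g (Icc 0 l) := by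
  have h1 : EqOn f g (Ioo 0 l) :=
    Measure.eqOn_open_of_ae_eq h isOpen_Ioo (hf.mono Ioo_subset_Icc_self)
      (hg.mono Ioo_subset_Icc_self)
  exact h1.of_subset_closure hf hg Ioo_subset_Icc_self (by rw [closure_Ioo hl.ne])

namespace IsPrim

variable {p l : ℝ} {u g : ℝ → ℝ}

theorem absolutelyContinuousOnInterval_primitive (h : IsPrim p l u g) (hp : 1 < p) (hl : 0 < l) :
    AbsolutelyContinuousOnInterval (fun x => u 0 + ∫ t in (0 : ℝ)..x, g t) 0 l := by
  have h1 : AbsolutelyContinuousOnInterval (fun x => ∫ t in (0 : ℝ)..x, g t) 0 l :=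
    (h.1.intervalIntegrable_Ioo hp hl.le).absolutelyContinuousOnInterval_intervalIntegral (by simp)
  have h0 : AbsolutelyContinuousOnInterval (fun _ : ℝ => u 0) 0 l :=
    (contDiffOn_const (n := 1)).absolutelyContinuousOnInterval
  exact h0.fun_add h1

theorem absolutelyContinuousOnInterval (h : IsPrim p l u g) (hp : 1 < p) (hl : 0 < l) :
    AbsolutelyContinuousOnInterval u 0 l := by
  have := h.absolutelyContinuousOnInterval_primitive hp hl
  -- `u` agrees with the primitive only on [0, l], so the ε-δ condition, which involves only points
  -- of that interval, is transferred.
  rw [absolutelyContinuousOnInterval_iff] at this ⊢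
  intro ε hε
  obtain ⟨δ, hδ, H⟩ := this ε hε
  refine ⟨δ, hδ, fun E hE hE' => ?_⟩
  have := H E hE hE'
  refine (Finset.sum_congr rfl fun i hi => ?_).trans_lt this
  have hm := hE.1 i hi
  rw [uIcc_of_le hl.le] at hm
  rw [h.2 _ hm.1, h.2 _ hm.2]

theorem continuousOn (h : IsPrim p l u g) (hp : 1 < p) (hl : 0 < l) :
    ContinuousOn u (Icc 0 l) := by
  have := (h.absolutelyContinuousOnInterval hp hl).continuousOn
  rwa [uIcc_of_le hl.le] at this

theorem ae_hasDerivAt (h : IsPrim p l u g) (hp : 1 < p) (hl : 0 < l) :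
    ∀ᵐ x ∂volume.restrict (Ioo 0 l), HasDerivAt u (g x) x := by
  rw [ae_restrict_iff' measurableSet_Ioo]
  filter_upwards [(h.1.intervalIntegrable_Ioo hp hl.le).ae_hasDerivAt_integral] with x hx hx'
  have h1 := hx (by rw [uIcc_of_le hl.le]; exact Ioo_subset_Icc_self hx') 0 (by simp)
  have h2 : HasDerivAt (fun x => u 0 + ∫ t in (0 : ℝ)..x, g t) (g x) x := h1.const_add _
  refine h2.congr_of_eventuallyEq ?_
  filter_upwards [Ioo_mem_nhds hx'.1 hx'.2] with y hy
  exact h.2 y (Ioo_subset_Icc_self hy)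

theorem hasWeakDerivOn (h : IsPrim p l u g) (hp : 1 < p) (hl : 0 < l) : HasWeakDerivOn l u g := by
  have hc := h.continuousOn hp hl
  refine ⟨(hc.mono Ioo_subset_Icc_self).locallyIntegrableOn measurableSet_Ioo,
    (h.1.integrableOn_Ioo hp).locallyIntegrableOn, fun φ hφ hφC hφS => ?_⟩
  rw [← integral_primitive_mul_deriv hl.le (h.1.intervalIntegrable_Ioo hp hl.le) hφ hφS]
  have hd : Continuous (deriv φ) := hφ.continuous_deriv (by simp)
  have i0 : IntegrableOn (fun x => u x * deriv φ x) (Ioo 0 l) :=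
    ((hc.mul hd.continuousOn).integrableOn_Icc).mono_set Ioo_subset_Icc_self
  have i1 : IntegrableOn (fun x => u 0 * deriv φ x) (Ioo 0 l) :=
    ((continuousOn_const.mul hd.continuousOn).integrableOn_Icc).mono_set Ioo_subset_Icc_self
  have e1 : ∫ x in Ioo 0 l, u 0 * deriv φ x = 0 := by
    rw [integral_const_mul, setIntegral_Ioo_eq_intervalIntegral hl.le,
      intervalIntegral.integral_deriv_eq_sub
        (fun x _ => (hφ.differentiable (by simp)).differentiableAt)
        (hd.intervalIntegrable _ _),
      image_eq_zero_of_notMem_tsupport (f := φ) fun h => by simpa using hφS h,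
      image_eq_zero_of_notMem_tsupport (f := φ) fun h => by simpa using hφS h]
    simp
  have e2 : ∫ x in Ioo 0 l, u x * deriv φ x =
      (∫ x in Ioo 0 l, u x * deriv φ x) - ∫ x in Ioo 0 l, u 0 * deriv φ x := by rw [e1, sub_zero]
  rw [e2, ← integral_sub i0 i1]
  refine setIntegral_congr_fun measurableSet_Ioo fun x hx => ?_
  rw [h.2 x (Ioo_subset_Icc_self hx)]
  ring

end IsPrim

/-- The difference of the two candidates annihilates every test function. This makes the arbitrary
choice in `weakDerivOn` harmless. -/
theorem HasWeakDerivOn.ae_unique {l : ℝ} {f g₁ g₂ : ℝ → ℝ}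
    (h₁ : HasWeakDerivOn l f g₁) (h₂ : HasWeakDerivOn l f g₂) :
    g₁ =ᵐ[volume.restrict (Ioo 0 l)] g₂ := by
  have := isOpen_Ioo.ae_eq_zero_of_integral_contDiff_smul_eq_zero (μ := volume)
    (f := fun x => g₁ x - g₂ x) (U := Ioo 0 l) (h₁.2.1.sub h₂.2.1) ?_
  · rw [Filter.EventuallyEq, ae_restrict_iff' measurableSet_Ioo]
    filter_upwards [this] with x hx hx'
    linarith [hx hx']
  intro ψ hψ hψC hψS
  have key : ∀ g : ℝ → ℝ, LocallyIntegrableOn g (Ioo 0 l) → IntegrableOn (fun x => g x * ψ x)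
      (Ioo 0 l) := by
    intro g hg
    have hi : IntegrableOn g (tsupport ψ) := hg.integrableOn_compact_subset hψS hψC
    have : IntegrableOn (fun x => g x * ψ x) (tsupport ψ) :=
      hi.mul_continuousOn hψ.continuous.continuousOn hψC
    rw [integrableOn_iff_integrable_of_support_subset] at this
    · exact this.integrableOn
    · exact (Function.support_mul_subset_right _ _).trans (subset_tsupport _)
  have e := (h₁.2.2 ψ hψ hψC hψS).symm.trans (h₂.2.2 ψ hψ hψC hψS)
  rw [neg_inj, ← sub_eq_zero, ← integral_sub (key _ h₁.2.1) (key _ h₂.2.1)] at e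
  rw [← e, ← setIntegral_eq_integral_of_forall_compl_eq_zero (s := Ioo 0 l)]
  · congr 1; ext x; simp only [smul_eq_mul]; ring
  · intro x hx
    rw [image_eq_zero_of_notMem_tsupport fun h => hx (hψS h), zero_smul]

theorem HasWeakDerivOn.weakDerivOn_ae_eq {l : ℝ} {f g : ℝ → ℝ} (h : HasWeakDerivOn l f g) :
    weakDerivOn l f =ᵐ[volume.restrict (Ioo 0 l)] g := by
  have hex : ∃ g, HasWeakDerivOn l f g := ⟨g, h⟩
  rw [weakDerivOn, dif_pos hex]
  exact hex.choose_spec.ae_unique h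

/-- A continuous function with an `L^p` weak derivative is a primitive of it. -/
theorem HasWeakDerivOn.isPrim {p l : ℝ} (hp : 1 < p) (hl : 0 < l) {u g : ℝ → ℝ}
    (hu : ContinuousOn u (Icc 0 l)) (h : HasWeakDerivOn l u g)
    (hg : MemLp g (ENNReal.ofReal p) (volume.restrict (Ioo 0 l))) : IsPrim p l u g := by
  refine ⟨hg, ?_⟩
  have hgi := hg.intervalIntegrable_Ioo hp hl.le
  have hF : ContinuousOn (fun x => ∫ t in (0 : ℝ)..x, g t) (Icc 0 l) := by
    have := (hgi.absolutelyContinuousOnInterval_intervalIntegral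
      (c := 0) (by simp)).continuousOn
    rwa [uIcc_of_le hl.le] at this
  have hd : ContinuousOn (fun x => u x - ∫ t in (0 : ℝ)..x, g t) (Icc 0 l) := hu.sub hF
  obtain ⟨c, hc⟩ := ae_const_of_integral_mul_deriv_eq_zero hl
    (h := fun x => u x - ∫ t in (0 : ℝ)..x, g t)
    ((hd.mono Ioo_subset_Icc_self).locallyIntegrableOn measurableSet_Ioo) (by
      intro φ hφ hφC hφS
      have hdc : Continuous (deriv φ) := hφ.continuous_deriv (by simp)
      have i0 : IntegrableOn (fun x => u x * deriv φ x) (Ioo 0 l) :=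
        ((hu.mul hdc.continuousOn).integrableOn_Icc).mono_set Ioo_subset_Icc_self
      have i1 : IntegrableOn (fun x => (∫ t in (0 : ℝ)..x, g t) * deriv φ x) (Ioo 0 l) :=
        ((hF.mul hdc.continuousOn).integrableOn_Icc).mono_set Ioo_subset_Icc_self
      simp_rw [sub_mul]
      rw [integral_sub i0 i1, h.2.2 φ hφ hφC hφS, integral_primitive_mul_deriv hl.le hgi hφ hφS,
        sub_self])
  have := eqOn_Icc_of_ae_eq hl hd continuousOn_const hc
  have h0 := this (left_mem_Icc.2 hl.le)
  simp only [intervalIntegral.integral_same, sub_zero] at h0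
  intro x hx
  have h1 := this hx
  simp only at h1
  linarith

theorem MemW1p.isPrim_weakDerivOn {p l : ℝ} (hp : 1 < p) (hl : 0 < l) {u : ℝ → ℝ}
    (hu : ContinuousOn u (Icc 0 l)) (h : MemW1p p l u) : IsPrim p l u (weakDerivOn l u) := by
  obtain ⟨-, g, hg, hgL⟩ := h
  have e := hg.weakDerivOn_ae_eq
  refine HasWeakDerivOn.isPrim hp hl hu ?_ ((memLp_congr_ae e).2 hgL)
  have hex : ∃ g, HasWeakDerivOn l u g := ⟨g, hg⟩
  rw [weakDerivOn, dif_pos hex]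
  exact hex.choose_spec

theorem IsPrim.memW1p {p l : ℝ} {u g : ℝ → ℝ} (h : IsPrim p l u g) (hp : 1 < p) (hl : 0 < l) :
    MemW1p p l u :=
  ⟨(h.continuousOn hp hl).memLp_Ioo, g, h.hasWeakDerivOn hp hl, h.1⟩

theorem IsPrim.weakDerivOn_ae_eq {p l : ℝ} {u g : ℝ → ℝ} (h : IsPrim p l u g) (hp : 1 < p)
    (hl : 0 < l) : weakDerivOn l u =ᵐ[volume.restrict (Ioo 0 l)] g :=
  (h.hasWeakDerivOn hp hl).weakDerivOn_ae_eq

/-- An absolutely continuous function whose derivative is a.e. dominated by an `L^p` function is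
a primitive of its derivative. -/
theorem AbsolutelyContinuousOnInterval.isPrim_deriv {p l : ℝ} (hl : 0 < l) {u G : ℝ → ℝ}
    (hu : AbsolutelyContinuousOnInterval u 0 l)
    (hG : MemLp G (ENNReal.ofReal p) (volume.restrict (Ioo 0 l)))
    (hle : ∀ᵐ x ∂volume.restrict (Ioo 0 l), |deriv u x| ≤ |G x|) : IsPrim p l u (deriv u) := by
  refine ⟨hG.mono (measurable_deriv u).aestronglyMeasurable hle, fun x hx => ?_⟩
  have : AbsolutelyContinuousOnInterval u 0 x := hu.mono (by
    rw [uIcc_of_le hl.le, uIcc_of_le hx.1]; exact Icc_subset_Icc_right hx.2)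
  rw [this.integral_deriv_eq_sub]
  ring

theorem AbsolutelyContinuousOnInterval.ae_hasDerivAt_Ioo {l : ℝ} (hl : 0 < l) {u : ℝ → ℝ}
    (hu : AbsolutelyContinuousOnInterval u 0 l) :
    ∀ᵐ x ∂volume.restrict (Ioo 0 l), HasDerivAt u (deriv u x) x := by
  rw [ae_restrict_iff' measurableSet_Ioo]
  filter_upwards [hu.ae_differentiableAt] with x hx hx'
  exact (hx (by rw [uIcc_of_le hl.le]; exact Ioo_subset_Icc_self hx')).hasDerivAt

theorem AbsolutelyContinuousOnInterval.abs {a b : ℝ} {u : ℝ → ℝ}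
    (hu : AbsolutelyContinuousOnInterval u a b) :
    AbsolutelyContinuousOnInterval (fun x => |u x|) a b := by
  rw [absolutelyContinuousOnInterval_iff] at hu ⊢
  intro ε hε
  obtain ⟨δ, hδ, H⟩ := hu ε hε
  refine ⟨δ, hδ, fun E hE hE' => (Finset.sum_le_sum fun i _ => ?_).trans_lt (H E hE hE')⟩
  exact abs_abs_sub_abs_le_abs_sub _ _

/-! ### The odd power and differentiation of the p-th power integral. -/

/-- The odd power `s ↦ |s|^{q-2} s`. -/
noncomputable def signedPow (q s : ℝ) : ℝ := |s| ^ (q - 2) * s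

theorem abs_signedPow {q : ℝ} (hq : 1 < q) (s : ℝ) : |signedPow q s| = |s| ^ (q - 1) := by
  rw [signedPow, abs_mul, abs_of_nonneg (Real.rpow_nonneg (abs_nonneg s) _),
    ← Real.rpow_add_one' (abs_nonneg s) (by linarith)]
  ring_nf

theorem signedPow_mul_self {q : ℝ} (hq : 1 < q) (s : ℝ) : signedPow q s * s = |s| ^ q := by
  have h : |s| ^ q = |s| ^ (q - 1) * |s| := by
    rw [← Real.rpow_add_one' (abs_nonneg s) (by linarith)]; ring_nf
  rw [h, ← abs_signedPow hq, ← abs_mul, abs_of_nonneg]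
  rw [signedPow, mul_assoc]
  exact mul_nonneg (Real.rpow_nonneg (abs_nonneg s) _) (mul_self_nonneg s)

theorem signedPow_nonneg {q s : ℝ} (hs : 0 ≤ s) : 0 ≤ signedPow q s :=
  mul_nonneg (Real.rpow_nonneg (abs_nonneg s) _) hs

theorem signedPow_nonpos {q s : ℝ} (hs : s ≤ 0) : signedPow q s ≤ 0 :=
  mul_nonpos_of_nonneg_of_nonpos (Real.rpow_nonneg (abs_nonneg s) _) hs

theorem signedPow_pos {q s : ℝ} (hs : 0 < s) : 0 < signedPow q s :=
  mul_pos (Real.rpow_pos_of_pos (abs_pos.2 hs.ne') _) hs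

theorem signedPow_neg_of_neg {q s : ℝ} (hs : s < 0) : signedPow q s < 0 :=
  mul_neg_of_pos_of_neg (Real.rpow_pos_of_pos (abs_pos.2 hs.ne) _) hs

/-- Conjugacy says (p-1)r = p, which cancels the exponents. Through this inversion u' is recovered
from the flux. -/
theorem signedPow_signedPow {p r : ℝ} (h : p.HolderConjugate r) (s : ℝ) :
    signedPow r (signedPow p s) = s := by
  rcases eq_or_ne s 0 with rfl | hs
  · simp [signedPow]
  have hs' : 0 < |s| := abs_pos.2 hs
  have e : (p - 1) * (r - 2) + (p - 2) = 0 := by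
    have := h.sub_one_mul_conj
    linear_combination this
  rw [signedPow, abs_signedPow h.lt, ← Real.rpow_mul hs'.le, signedPow, ← mul_assoc,
    ← Real.rpow_add hs', e, Real.rpow_zero, one_mul]

/-- For q < 2 the factor |s|^(q-2) is itself discontinuous at 0; continuity comes instead from |s|^q
being C¹ with derivative q times the odd power. -/
theorem continuous_signedPow {q : ℝ} (hq : 1 < q) : Continuous (signedPow q) := by
  have h : Continuous (deriv fun x : ℝ => |x| ^ q) := by
    have := (contDiff_norm_rpow (E := ℝ) hq).continuous_deriv le_rfl
    simpa using this
  have e : signedPow q = fun x => (deriv fun x : ℝ => |x| ^ q) x / q := by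
    ext x
    rw [(hasDerivAt_abs_rpow x hq).deriv, signedPow]
    field_simp
  rw [e]
  exact h.div_const q

section Integral

variable {α : Type*} [MeasurableSpace α] {μ : Measure α} {p : ℝ} {a b : α → ℝ}

theorem MeasureTheory.MemLp.integrable_abs_rpow (hp : 1 < p) (ha : MemLp a (ENNReal.ofReal p) μ) :
    Integrable (fun x => |a x| ^ p) μ := by
  have := ha.integrable_norm_rpow (by simp; linarith) (by simp)
  rwa [ENNReal.toReal_ofReal (by linarith)] at this

/-- The derivative of the `p`-th power of the `L^p` norm along a line. -/
theorem hasDerivAt_integral_abs_rpow (hp : 1 < p) (ha : MemLp a (ENNReal.ofReal p) μ)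
    (hb : MemLp b (ENNReal.ofReal p) μ) :
    Integrable (fun x => signedPow p (a x) * b x) μ ∧
      HasDerivAt (fun t : ℝ => ∫ x, |a x + t * b x| ^ p ∂μ)
        (p * ∫ x, signedPow p (a x) * b x ∂μ) 0 := by
  have hab : MemLp (fun x => |a x| + |b x|) (ENNReal.ofReal p) μ := ha.abs.add hb.abs
  have key := hasDerivAt_integral_of_dominated_loc_of_deriv_le (μ := μ) (𝕜 := ℝ) (x₀ := 0)
    (s := Metric.ball 0 1) (F := fun t x => |a x + t * b x| ^ p)
    (F' := fun t x => p * signedPow p (a x + t * b x) * b x)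
    -- For |t| ≤ 1 one has |a + tb|^(p-1) |b| ≤ (|a| + |b|)^p.
    (bound := fun x => p * |(|a x| + |b x|)| ^ p) (Metric.ball_mem_nhds 0 one_pos)
    (Filter.Eventually.of_forall fun t =>
      ((ha.add (hb.const_mul t)).integrable_abs_rpow hp).aestronglyMeasurable)
    (by simpa using ha.integrable_abs_rpow hp)
    (by
      simp only [zero_mul, add_zero]
      exact ((continuous_signedPow hp).comp_aestronglyMeasurable
        ha.aestronglyMeasurable |>.const_mul p).mul hb.aestronglyMeasurable)
    (by
      refine Filter.Eventually.of_forall fun x t ht => ?_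
      have ht' : |t| ≤ 1 := by
        rw [mem_ball_zero_iff, Real.norm_eq_abs] at ht
        exact ht.le
      have h0 : 0 ≤ |a x| + |b x| := by positivity
      rw [Real.norm_eq_abs, abs_mul, abs_mul, abs_signedPow hp, abs_of_pos (by linarith : 0 < p),
        mul_assoc, abs_of_nonneg h0]
      have h1 : |a x + t * b x| ≤ |a x| + |b x| := by
        refine (abs_add_le _ _).trans ?_
        rw [abs_mul]
        nlinarith [abs_nonneg (b x)]
      have h2 : (|a x| + |b x|) ^ p = (|a x| + |b x|) ^ (p - 1) * (|a x| + |b x|) := by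
        rw [← Real.rpow_add_one' h0 (by linarith)]; ring_nf
      rw [h2]
      refine mul_le_mul_of_nonneg_left ?_ (by linarith)
      exact mul_le_mul (Real.rpow_le_rpow (abs_nonneg _) h1 (by linarith))
        (by linarith [abs_nonneg (a x)]) (abs_nonneg _) (Real.rpow_nonneg h0 _))
    ((hab.integrable_abs_rpow hp).const_mul p)
    (by
      refine Filter.Eventually.of_forall fun x t _ => ?_
      have h1 : HasDerivAt (fun t : ℝ => a x + t * b x) (b x) t := by
        simpa using ((hasDerivAt_id t).mul_const (b x)).const_add (a x)
      have := (hasDerivAt_abs_rpow (a x + t * b x) hp).comp t h1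
      simpa [signedPow, mul_assoc, Function.comp_def] using this)
  simp only [zero_mul, add_zero, mul_assoc] at key
  refine ⟨?_, ?_⟩
  · have := key.1.const_mul p⁻¹
    simpa [inv_mul_cancel_left₀ (by linarith : p ≠ 0)] using this
  · rw [← integral_const_mul]
    exact key.2

end Integral

/-! ### Sums, multiples, modulus, maximum and minimum of primitives. -/

namespace IsPrim

variable {p l : ℝ} {u v g h : ℝ → ℝ}

theorem intervalIntegrable_of_mem (H : IsPrim p l u g) (hp : 1 < p) (hl : 0 < l) {x : ℝ}
    (hx : x ∈ Icc 0 l) : IntervalIntegrable g volume 0 x :=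
  (H.1.intervalIntegrable_Ioo hp hl.le).mono_set (by
    rw [uIcc_of_le hl.le, uIcc_of_le hx.1]; exact Icc_subset_Icc_right hx.2)

theorem add (hp : 1 < p) (hl : 0 < l) (hu : IsPrim p l u g) (hv : IsPrim p l v h) :
    IsPrim p l (fun x => u x + v x) (fun x => g x + h x) := by
  refine ⟨hu.1.add hv.1, fun x hx => ?_⟩
  simp only
  rw [hu.2 x hx, hv.2 x hx, intervalIntegral.integral_add (hu.intervalIntegrable_of_mem hp hl hx)
    (hv.intervalIntegrable_of_mem hp hl hx)]
  ring

theorem const_mul (hu : IsPrim p l u g) (c : ℝ) :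
    IsPrim p l (fun x => c * u x) (fun x => c * g x) := by
  refine ⟨hu.1.const_mul c, fun x hx => ?_⟩
  simp only
  rw [hu.2 x hx, intervalIntegral.integral_const_mul]
  ring

/-- Almost everywhere u and |u| are both differentiable. Where u ≠ 0 its sign is locally constant;
where u = 0, both |u| and |u| - u have a minimum, so both derivatives vanish. -/
theorem abs (hp : 1 < p) (hl : 0 < l) (hu : IsPrim p l u g) :
    ∃ g', IsPrim p l (fun x => |u x|) g' ∧
      ∀ᵐ x ∂volume.restrict (Ioo 0 l), |g' x| = |g x| := by
  have hA := (hu.absolutelyContinuousOnInterval hp hl).abs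
  have key : ∀ᵐ x ∂volume.restrict (Ioo 0 l), |deriv (fun x => |u x|) x| = |g x| := by
    filter_upwards [hA.ae_hasDerivAt_Ioo hl, hu.ae_hasDerivAt hp hl] with x h1 h2
    rcases lt_trichotomy (u x) 0 with h | h | h
    · have : (fun x => |u x|) =ᶠ[nhds x] fun x => - u x := by
        filter_upwards [h2.continuousAt.eventually_lt_const h] with y hy using abs_of_neg hy
      rw [this.deriv_eq, h2.fun_neg.deriv, abs_neg]
    · have e1 : deriv (fun x => |u x|) x = 0 :=
        IsLocalMin.hasDerivAt_eq_zero (Filter.Eventually.of_forall fun y => by simp [h]) h1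
      have e2 : deriv (fun x => |u x|) x - g x = 0 :=
        IsLocalMin.hasDerivAt_eq_zero (f := fun y => |u y| - u y)
          (Filter.Eventually.of_forall fun y => by simp [h, le_abs_self]) (h1.sub h2)
      rw [← sub_eq_zero.1 e2]
    · have : (fun x => |u x|) =ᶠ[nhds x] u := by
        filter_upwards [h2.continuousAt.eventually_const_lt h] with y hy using abs_of_pos hy
      rw [this.deriv_eq, h2.deriv]
  exact ⟨_, hA.isPrim_deriv hl hu.1 (key.mono fun x hx => hx.le), key⟩

/-- Almost everywhere the derivatives of max and min are those of u and v in some order. At a point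
with u = v this holds because max - u and v - min attain their minimum 0 there. -/
theorem max_min (hp : 1 < p) (hl : 0 < l) (hu : IsPrim p l u g) (hv : IsPrim p l v h) :
    ∃ M m, IsPrim p l (fun x => max (u x) (v x)) M ∧ IsPrim p l (fun x => min (u x) (v x)) m ∧
      ∀ᵐ x ∂volume.restrict (Ioo 0 l), |M x| ^ p + |m x| ^ p = |g x| ^ p + |h x| ^ p := by
  have hAu := hu.absolutelyContinuousOnInterval hp hl
  have hAv := hv.absolutelyContinuousOnInterval hp hl
  have hM : AbsolutelyContinuousOnInterval (fun x => max (u x) (v x)) 0 l := by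
    have := ((hAu.fun_add hAv).fun_add (hAu.fun_sub hAv).abs).const_mul (1 / 2)
    convert this using 1
    ext x
    rcases le_total (u x) (v x) with h | h
    · rw [max_eq_right h, abs_of_nonpos (by linarith)]; ring
    · rw [max_eq_left h, abs_of_nonneg (by linarith)]; ring
  have hm : AbsolutelyContinuousOnInterval (fun x => min (u x) (v x)) 0 l := by
    have := (hAu.fun_add hAv).fun_sub hM
    have e : (fun x => min (u x) (v x)) = fun x => u x + v x - max (u x) (v x) :=
      funext fun x => by linarith [min_add_max (u x) (v x)]
    rwa [e]
  have key : ∀ᵐ x ∂volume.restrict (Ioo 0 l),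
      (deriv (fun x => max (u x) (v x)) x = g x ∧ deriv (fun x => min (u x) (v x)) x = h x) ∨
      (deriv (fun x => max (u x) (v x)) x = h x ∧ deriv (fun x => min (u x) (v x)) x = g x) := by
    filter_upwards [hM.ae_hasDerivAt_Ioo hl, hm.ae_hasDerivAt_Ioo hl, hu.ae_hasDerivAt hp hl,
      hv.ae_hasDerivAt hp hl] with x h1 h2 h3 h4
    rcases lt_trichotomy (u x) (v x) with h | h | h
    · right
      have h5 := h3.continuousAt.eventually_lt h4.continuousAt h
      rw [Filter.EventuallyEq.deriv_eq (h5.mono fun y hy => max_eq_right hy.le),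
        Filter.EventuallyEq.deriv_eq (h5.mono fun y hy => min_eq_left hy.le), h4.deriv, h3.deriv]
      exact ⟨rfl, rfl⟩
    · left
      have e1 := IsLocalMin.hasDerivAt_eq_zero (a := x) (f := fun y => max (u y) (v y) - u y)
          (Filter.Eventually.of_forall fun y => by simp [h]) (h1.sub h3)
      have e2 := IsLocalMin.hasDerivAt_eq_zero (a := x) (f := fun y => v y - min (u y) (v y))
          (Filter.Eventually.of_forall fun y => by simp [h]) (h4.sub h2)
      constructor <;> linarith
    · left
      have h5 := h4.continuousAt.eventually_lt h3.continuousAt h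
      rw [Filter.EventuallyEq.deriv_eq (h5.mono fun y hy => max_eq_left hy.le),
        Filter.EventuallyEq.deriv_eq (h5.mono fun y hy => min_eq_right hy.le), h4.deriv, h3.deriv]
      exact ⟨rfl, rfl⟩
  have hG : MemLp (fun x => |g x| + |h x|) (ENNReal.ofReal p) (volume.restrict (Ioo 0 l)) :=
    hu.1.abs.add hv.1.abs
  refine ⟨_, _, hM.isPrim_deriv hl hG ?_, hm.isPrim_deriv hl hG ?_, ?_⟩
  · filter_upwards [key] with x hx
    have h0 : 0 ≤ |g x| + |h x| := by positivity
    rw [abs_of_nonneg h0]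
    rcases hx with hx | hx <;> rw [hx.1] <;> linarith [abs_nonneg (g x), abs_nonneg (h x)]
  · filter_upwards [key] with x hx
    have h0 : 0 ≤ |g x| + |h x| := by positivity
    rw [abs_of_nonneg h0]
    rcases hx with hx | hx <;> rw [hx.2] <;> linarith [abs_nonneg (g x), abs_nonneg (h x)]
  · filter_upwards [key] with x hx
    rcases hx with hx | hx <;> rw [hx.1, hx.2]
    ring

/-- A continuously differentiable function is a primitive of its derivative. -/
theorem of_hasDerivAt (hu : ∀ x, HasDerivAt u (g x) x)
    (hg : Continuous g) : IsPrim p l u g := by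
  refine ⟨hg.continuousOn.memLp_Ioo, fun x _ => ?_⟩
  rw [intervalIntegral.integral_eq_sub_of_hasDerivAt (fun y _ => hu y) (hg.intervalIntegrable _ _)]
  ring

end IsPrim

/-! ### The flux of a weak solution on one edge. -/

section Flux

variable {p r lam l : ℝ} {u g : ℝ → ℝ}

/-- The flux `C - lam * ∫_0^x |u|^{p-2} u`. -/
noncomputable def flux (p lam C : ℝ) (u : ℝ → ℝ) (x : ℝ) : ℝ :=
  C - lam * ∫ t in (0 : ℝ)..x, signedPow p (u t)

theorem intervalIntegrable_signedPow (hp : 1 < p) (hl : 0 < l) (hu : ContinuousOn u (Icc 0 l)) :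
    IntervalIntegrable (fun t => signedPow p (u t)) volume 0 l :=
  ContinuousOn.intervalIntegrable (by
    rw [uIcc_of_le hl.le]; exact (continuous_signedPow hp).comp_continuousOn hu)

theorem absolutelyContinuousOnInterval_flux (hp : 1 < p) (hl : 0 < l)
    (hu : ContinuousOn u (Icc 0 l)) (lam C : ℝ) :
    AbsolutelyContinuousOnInterval (flux p lam C u) 0 l := by
  have h1 := ((intervalIntegrable_signedPow hp hl
    hu).absolutelyContinuousOnInterval_intervalIntegral (c := 0) (by simp)).const_mul lam
  have h0 : AbsolutelyContinuousOnInterval (fun _ : ℝ => C) 0 l :=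
    (contDiffOn_const (n := 1)).absolutelyContinuousOnInterval
  exact h0.fun_sub h1

theorem continuousOn_flux (hp : 1 < p) (hl : 0 < l)
    (hu : ContinuousOn u (Icc 0 l)) (lam C : ℝ) : ContinuousOn (flux p lam C u) (Icc 0 l) := by
  have := (absolutelyContinuousOnInterval_flux hp hl hu lam C).continuousOn
  rwa [uIcc_of_le hl.le] at this

/-- A weak solution on an interval has an absolutely continuous flux. -/
theorem IsPrim.exists_flux (hp : 1 < p) (hl : 0 < l) (hu : IsPrim p l u g)
    (H : ∀ φ : ℝ → ℝ, ContDiff ℝ ∞ φ → HasCompactSupport φ → tsupport φ ⊆ Ioo 0 l →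
      ∫ x in Ioo 0 l, signedPow p (g x) * deriv φ x =
        lam * ∫ x in Ioo 0 l, signedPow p (u x) * φ x) :
    ∃ C, ∀ᵐ x ∂volume.restrict (Ioo 0 l), signedPow p (g x) = flux p lam C u x := by
  have hc := hu.continuousOn hp hl
  have hF := continuousOn_flux hp hl hc lam 0
  have hk := intervalIntegrable_signedPow hp hl hc
  -- Pairing with the constant 1 gives integrability of the odd power of `g`.
  have hgi : IntegrableOn (fun x => signedPow p (g x)) (Ioo 0 l) := by
    have := (hasDerivAt_integral_abs_rpow hp hu.1
      (b := fun _ => 1) (continuousOn_const.memLp_Ioo)).1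
    simpa [IntegrableOn] using this
  obtain ⟨C, hC⟩ := ae_const_of_integral_mul_deriv_eq_zero hl
    (h := fun x => signedPow p (g x) - flux p lam 0 u x)
    (hgi.locallyIntegrableOn.sub ((hF.mono Ioo_subset_Icc_self).locallyIntegrableOn
      measurableSet_Ioo)) (by
      intro φ hφ hφC hφS
      have hdc : Continuous (deriv φ) := hφ.continuous_deriv (by simp)
      have i0 : IntegrableOn (fun x => signedPow p (g x) * deriv φ x) (Ioo 0 l) :=
        (hasDerivAt_integral_abs_rpow hp hu.1 hdc.continuousOn.memLp_Ioo).1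
      have i1 : IntegrableOn (fun x => flux p lam 0 u x * deriv φ x) (Ioo 0 l) :=
        ((hF.mul hdc.continuousOn).integrableOn_Icc).mono_set Ioo_subset_Icc_self
      simp_rw [sub_mul]
      rw [integral_sub i0 i1, H φ hφ hφC hφS]
      have := integral_primitive_mul_deriv hl.le hk hφ hφS
      simp only [flux, zero_sub, neg_mul, mul_assoc]
      rw [integral_neg, integral_const_mul, this]
      ring)
  refine ⟨C, hC.mono fun x hx => ?_⟩
  simp only [flux] at hx ⊢
  linarith

/-- Inverting the odd power gives u' almost everywhere as a continuous function of the flux; this is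
the regularity gain that makes u of class C¹ inside the edge. -/
theorem IsPrim.of_flux (h : p.HolderConjugate r) (hu : IsPrim p l u g) {C : ℝ}
    (hC : ∀ᵐ x ∂volume.restrict (Ioo 0 l), signedPow p (g x) = flux p lam C u x) :
    ∀ x ∈ Icc 0 l, u x = u 0 + ∫ t in (0 : ℝ)..x, signedPow r (flux p lam C u t) := by
  intro x hx
  rw [hu.2 x hx]
  congr 1
  apply intervalIntegral.integral_congr_ae
  have : ∀ᵐ x ∂volume, x ∈ Ioo 0 l → signedPow p (g x) = flux p lam C u x :=
    (ae_restrict_iff' measurableSet_Ioo).1 hC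
  -- The equation is known only on the open interval, so the endpoint t = l has to be discarded when
  -- x = l.
  filter_upwards [this, Measure.ae_ne volume l] with t ht htl ht'
  rw [uIoc_of_le hx.1] at ht'
  rw [← ht ⟨ht'.1, lt_of_le_of_ne (ht'.2.trans hx.2) htl⟩, signedPow_signedPow h]

theorem continuousOn_signedPow_flux (hp : 1 < p) (hr : 1 < r) (hl : 0 < l)
    (hu : ContinuousOn u (Icc 0 l)) (lam C : ℝ) :
    ContinuousOn (fun t => signedPow r (flux p lam C u t)) (Icc 0 l) :=
  (continuous_signedPow hr).comp_continuousOn (continuousOn_flux hp hl hu lam C)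

/-- Solutions are continuously differentiable inside the edge. -/
theorem hasDerivAt_of_flux (hp : 1 < p) (hr : 1 < r) (hl : 0 < l)
    (hu : ContinuousOn u (Icc 0 l)) {C : ℝ}
    (h : ∀ x ∈ Icc 0 l, u x = u 0 + ∫ t in (0 : ℝ)..x, signedPow r (flux p lam C u t))
    {x : ℝ} (hx : x ∈ Ioo 0 l) : HasDerivAt u (signedPow r (flux p lam C u x)) x := by
  have hc := continuousOn_signedPow_flux hp hr hl hu lam C
  have h1 : HasDerivAt (fun x => u 0 + ∫ t in (0 : ℝ)..x, signedPow r (flux p lam C u t))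
      (signedPow r (flux p lam C u x)) x := by
    refine (intervalIntegral.integral_hasDerivAt_right ?_ ?_ ?_).const_add _
    · refine ContinuousOn.intervalIntegrable (hc.mono ?_)
      rw [uIcc_of_le hx.1.le]; exact Icc_subset_Icc_right hx.2.le
    · exact (hc.mono Ioo_subset_Icc_self).stronglyMeasurableAtFilter isOpen_Ioo x hx
    · exact hc.continuousAt (Icc_mem_nhds hx.1 hx.2)
  refine h1.congr_of_eventuallyEq ?_
  filter_upwards [Ioo_mem_nhds hx.1 hx.2] with y hy
  exact h y (Ioo_subset_Icc_self hy)

theorem sub_eq_integral_of_flux (hp : 1 < p) (hr : 1 < r) (hl : 0 < l)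
    (hu : ContinuousOn u (Icc 0 l)) {C : ℝ}
    (h : ∀ x ∈ Icc 0 l, u x = u 0 + ∫ t in (0 : ℝ)..x, signedPow r (flux p lam C u t))
    {x y : ℝ} (hx : x ∈ Icc 0 l) (hy : y ∈ Icc 0 l) :
    u y - u x = ∫ t in x..y, signedPow r (flux p lam C u t) := by
  have hi : ∀ z ∈ Icc 0 l, IntervalIntegrable (fun t => signedPow r (flux p lam C u t)) volume 0 z := by
    intro z hz
    refine ContinuousOn.intervalIntegrable
      ((continuousOn_signedPow_flux hp hr hl hu lam C).mono ?_)
    rw [uIcc_of_le hz.1]; exact Icc_subset_Icc_right hz.2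
  rw [h x hx, h y hy, ← intervalIntegral.integral_interval_sub_left (hi y hy) (hi x hx)]
  ring

theorem antitoneOn_flux (hp : 1 < p) (hlam : 0 ≤ lam) (hl : 0 < l)
    (hu : ContinuousOn u (Icc 0 l)) (hpos : ∀ x ∈ Icc 0 l, 0 ≤ u x) (C : ℝ) :
    AntitoneOn (flux p lam C u) (Icc 0 l) := by
  intro x hx y hy hxy
  simp only [flux]
  gcongr
  refine intervalIntegral.integral_mono_interval le_rfl hx.1 hxy ?_ ?_
  · filter_upwards [ae_restrict_mem measurableSet_Ioc] with t ht
    exact signedPow_nonneg (hpos t ⟨ht.1.le, ht.2.trans hy.2⟩)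
  · refine (intervalIntegrable_signedPow hp hl hu).mono_set ?_
    rw [uIcc_of_le hl.le, uIcc_of_le hy.1]; exact Icc_subset_Icc_right hy.2

/-- At a zero of a nonnegative supersolution the flux to the right is nonnegative. -/
theorem flux_nonneg_of_zero (hp : 1 < p) (hr : 1 < r) (hlam : 0 ≤ lam) (hl : 0 < l)
    (hu : ContinuousOn u (Icc 0 l)) (hpos : ∀ x ∈ Icc 0 l, 0 ≤ u x) {C : ℝ}
    (h : ∀ x ∈ Icc 0 l, u x = u 0 + ∫ t in (0 : ℝ)..x, signedPow r (flux p lam C u t))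
    {x : ℝ} (hx : x ∈ Ico 0 l) (hux : u x = 0) : 0 ≤ flux p lam C u x := by
  -- The flux is nonincreasing, so it would stay negative on [x, l] and force u(l) < u(x) = 0.
  by_contra! hneg
  have hx' := Ico_subset_Icc_self hx
  have hlm : l ∈ Icc 0 l := right_mem_Icc.2 hl.le
  have e := sub_eq_integral_of_flux hp hr hl hu h hx' hlm
  have hc : ContinuousOn (fun t => - signedPow r (flux p lam C u t)) (Icc x l) :=
    ((continuousOn_signedPow_flux hp hr hl hu lam C).mono (Icc_subset_Icc_left hx.1)).neg
  have : 0 < ∫ t in x..l, - signedPow r (flux p lam C u t) := by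
    refine intervalIntegral.intervalIntegral_pos_of_pos_on
      (ContinuousOn.intervalIntegrable (by rwa [uIcc_of_le hx.2.le])) (fun t ht => ?_) hx.2
    have := antitoneOn_flux hp hlam hl hu hpos C hx' ⟨hx.1.trans ht.1.le, ht.2.le⟩ ht.1.le
    linarith [signedPow_neg_of_neg (q := r) (this.trans_lt hneg)]
  rw [intervalIntegral.integral_neg] at this
  linarith [hpos l hlm]

/-- At a zero of a nonnegative supersolution the flux from the left is nonpositive. -/
theorem flux_nonpos_of_zero (hp : 1 < p) (hr : 1 < r) (hlam : 0 ≤ lam) (hl : 0 < l)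
    (hu : ContinuousOn u (Icc 0 l)) (hpos : ∀ x ∈ Icc 0 l, 0 ≤ u x) {C : ℝ}
    (h : ∀ x ∈ Icc 0 l, u x = u 0 + ∫ t in (0 : ℝ)..x, signedPow r (flux p lam C u t))
    {x : ℝ} (hx : x ∈ Ioc 0 l) (hux : u x = 0) : flux p lam C u x ≤ 0 := by
  -- The flux would be positive on [0, x], forcing u(0) < u(x) = 0.
  by_contra! hneg
  have hx' := Ioc_subset_Icc_self hx
  have hlm : 0 ∈ Icc 0 l := left_mem_Icc.2 hl.le
  have e := sub_eq_integral_of_flux hp hr hl hu h hlm hx'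
  have hc : ContinuousOn (fun t => signedPow r (flux p lam C u t)) (Icc 0 x) :=
    ((continuousOn_signedPow_flux hp hr hl hu lam C).mono (Icc_subset_Icc_right hx.2))
  have : 0 < ∫ t in (0 : ℝ)..x, signedPow r (flux p lam C u t) := by
    refine intervalIntegral.intervalIntegral_pos_of_pos_on
      (ContinuousOn.intervalIntegrable (by rwa [uIcc_of_le hx.1.le])) (fun t ht => ?_) hx.1
    have := antitoneOn_flux hp hlam hl hu hpos C ⟨ht.1.le, ht.2.le.trans hx.2⟩ hx' ht.2.le
    exact signedPow_pos (hneg.trans_le this)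
  linarith [hpos 0 hlm]

/-- A nonnegative supersolution that vanishes together with its flux vanishes identically. -/
theorem eq_zero_of_flux_eq_zero (hp : 1 < p) (hr : 1 < r) (hlam : 0 ≤ lam) (hl : 0 < l)
    (hu : ContinuousOn u (Icc 0 l)) (hpos : ∀ x ∈ Icc 0 l, 0 ≤ u x) {C : ℝ}
    (h : ∀ x ∈ Icc 0 l, u x = u 0 + ∫ t in (0 : ℝ)..x, signedPow r (flux p lam C u t))
    {x : ℝ} (hx : x ∈ Icc 0 l) (hux : u x = 0) (hfx : flux p lam C u x = 0) :
    ∀ y ∈ Icc 0 l, u y = 0 := by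
  intro y hy
  refine le_antisymm ?_ (hpos y hy)
  have e := sub_eq_integral_of_flux hp hr hl hu h hx hy
  -- The flux is nonpositive to the right of x and nonnegative to the left, so u ≤ u(x) = 0 on both
  -- sides.
  have hanti := antitoneOn_flux hp hlam hl hu hpos C
  rcases le_total x y with hxy | hxy
  · have : 0 ≤ ∫ t in x..y, - signedPow r (flux p lam C u t) := by
      refine intervalIntegral.integral_nonneg hxy fun t ht => ?_
      have := hanti hx ⟨hx.1.trans ht.1, ht.2.trans hy.2⟩ ht.1
      linarith [signedPow_nonpos (q := r) (this.trans_eq hfx)]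
    rw [intervalIntegral.integral_neg] at this
    linarith
  · have : 0 ≤ ∫ t in y..x, signedPow r (flux p lam C u t) := by
      refine intervalIntegral.integral_nonneg hxy fun t ht => ?_
      have := hanti ⟨hy.1.trans ht.1, ht.2.trans hx.2⟩ hx ht.2
      exact signedPow_nonneg (hfx.symm.trans_le this)
    rw [intervalIntegral.integral_symm] at this
    linarith

/-- Testing with an affine function yields the boundary fluxes. -/
theorem integral_flux_affine (hp : 1 < p) (hl : 0 < l) (hu : ContinuousOn u (Icc 0 l))
    (lam C α β : ℝ) :
    (∫ x in Ioo 0 l, flux p lam C u x * β) -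
        lam * ∫ x in Ioo 0 l, signedPow p (u x) * (α + β * x) =
      flux p lam C u l * (α + β * l) - flux p lam C u 0 * α := by
  have hd : ∀ x : ℝ, HasDerivAt (fun x : ℝ => α + β * x) β x := fun x => by
    simpa using ((hasDerivAt_id x).const_mul β).const_add α
  have hA : AbsolutelyContinuousOnInterval (fun x : ℝ => α + β * x) 0 l :=
    ContDiffOn.absolutelyContinuousOnInterval (by fun_prop)
  have key := (absolutelyContinuousOnInterval_flux hp hl hu lam
    C).integral_mul_deriv_eq_deriv_mul hA
  have e1 : ∫ x in (0 : ℝ)..l, deriv (flux p lam C u) x * (α + β * x) =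
      ∫ x in (0 : ℝ)..l, -(lam * (signedPow p (u x) * (α + β * x))) := by
    apply intervalIntegral.integral_congr_ae
    filter_upwards [(intervalIntegrable_signedPow hp hl hu).ae_hasDerivAt_integral] with x hx hx'
    have := hx (uIoc_subset_uIcc hx') 0 (by simp)
    have h2 : HasDerivAt (flux p lam C u) (-(lam * signedPow p (u x))) x :=
      (this.const_mul lam).const_sub C
    rw [h2.deriv]; ring
  simp only [(hd _).deriv] at key
  rw [e1, intervalIntegral.integral_neg, intervalIntegral.integral_const_mul] at key
  rw [setIntegral_Ioo_eq_intervalIntegral hl.le, setIntegral_Ioo_eq_intervalIntegral hl.le, key]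
  ring

end Flux

/-! ### Sobolev functions on the graph. -/

namespace MetricGraph

variable {V E : Type*} {Γ : MetricGraph V E} {p r lam : ℝ} {VD : Set V} {u v w g h : E → ℝ → ℝ}

/-- `u` is edgewise a primitive of the `L^p` function `g`, is continuous at the vertices and
vanishes on `VD`. -/
def IsGPrim (Γ : MetricGraph V E) (p : ℝ) (VD : Set V) (u g : E → ℝ → ℝ) : Prop :=
  (∀ e, IsPrim p (Γ.length e) (u e) (g e)) ∧
    ∃ f : V → ℝ, (∀ e, u e 0 = f (Γ.init e) ∧ u e (Γ.length e) = f (Γ.term e)) ∧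
      ∀ a ∈ VD, f a = 0

theorem MemX.isGPrim (hp : 1 < p) (hu : Γ.MemX p VD u) :
    Γ.IsGPrim p VD u (Γ.edgeDeriv u) := by
  classical
  obtain ⟨⟨hc, f, hf⟩, hW, hz⟩ := hu
  refine ⟨fun e => (hW e).isPrim_weakDerivOn hp (Γ.length_pos e) (hc e),
    -- `MemX` constrains u only along edges, so the given vertex function may be nonzero at a vertex
    -- of `VD` with no incident edge; it is overwritten there.
    fun a => if a ∈ VD then 0 else f a, fun e => ⟨?_, ?_⟩, fun a ha => if_pos ha⟩
  · dsimp only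
    split_ifs with ha
    · exact hz e 0 (left_mem_Icc.2 (Γ.length_pos e).le) (Or.inl ⟨rfl, ha⟩)
    · exact (hf e).1
  · dsimp only
    split_ifs with ha
    · exact hz e _ (right_mem_Icc.2 (Γ.length_pos e).le) (Or.inr ⟨rfl, ha⟩)
    · exact (hf e).2

namespace IsGPrim

theorem continuousOn (hp : 1 < p) (hu : Γ.IsGPrim p VD u g) (e : E) :
    ContinuousOn (u e) (Icc 0 (Γ.length e)) := (hu.1 e).continuousOn hp (Γ.length_pos e)

theorem memX (hp : 1 < p) (hu : Γ.IsGPrim p VD u g) : Γ.MemX p VD u := by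
  obtain ⟨f, hf, hz⟩ := hu.2
  refine ⟨⟨hu.continuousOn hp, f, hf⟩, fun e => (hu.1 e).memW1p hp (Γ.length_pos e), ?_⟩
  rintro e x - (⟨rfl, ha⟩ | ⟨rfl, ha⟩)
  · rw [(hf e).1, hz _ ha]
  · rw [(hf e).2, hz _ ha]

theorem edgeDeriv_ae_eq (hp : 1 < p) (hu : Γ.IsGPrim p VD u g) (e : E) :
    Γ.edgeDeriv u e =ᵐ[volume.restrict (Ioo 0 (Γ.length e))] g e :=
  (hu.1 e).weakDerivOn_ae_eq hp (Γ.length_pos e)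

theorem add (hp : 1 < p) (hu : Γ.IsGPrim p VD u g) (hv : Γ.IsGPrim p VD v h) :
    Γ.IsGPrim p VD (fun e x => u e x + v e x) (fun e x => g e x + h e x) := by
  obtain ⟨f₁, hf₁, hz₁⟩ := hu.2
  obtain ⟨f₂, hf₂, hz₂⟩ := hv.2
  refine ⟨fun e => (hu.1 e).add hp (Γ.length_pos e) (hv.1 e), fun a => f₁ a + f₂ a,
    fun e => ?_, fun a ha => ?_⟩
  · simp [(hf₁ e).1, (hf₁ e).2, (hf₂ e).1, (hf₂ e).2]
  · simp [hz₁ a ha, hz₂ a ha]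

theorem const_mul (hu : Γ.IsGPrim p VD u g) (c : ℝ) :
    Γ.IsGPrim p VD (fun e x => c * u e x) (fun e x => c * g e x) := by
  obtain ⟨f, hf, hz⟩ := hu.2
  refine ⟨fun e => (hu.1 e).const_mul c, fun a => c * f a, fun e => ?_, fun a ha => ?_⟩
  · simp [(hf e).1, (hf e).2]
  · simp [hz a ha]

theorem abs (hp : 1 < p) (hu : Γ.IsGPrim p VD u g) :
    ∃ g', Γ.IsGPrim p VD (fun e x => |u e x|) g' ∧
      ∀ e, ∀ᵐ x ∂volume.restrict (Ioo 0 (Γ.length e)), |g' e x| = |g e x| := by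
  obtain ⟨f, hf, hz⟩ := hu.2
  choose g' h1 h2 using fun e => (hu.1 e).abs hp (Γ.length_pos e)
  refine ⟨g', ⟨h1, fun a => |f a|, fun e => ?_, fun a ha => ?_⟩, h2⟩
  · simp [(hf e).1, (hf e).2]
  · simp [hz a ha]

theorem max_min (hp : 1 < p) (hu : Γ.IsGPrim p VD u g) (hv : Γ.IsGPrim p VD v h) :
    ∃ M m, Γ.IsGPrim p VD (fun e x => max (u e x) (v e x)) M ∧
      Γ.IsGPrim p VD (fun e x => min (u e x) (v e x)) m ∧
      ∀ e, ∀ᵐ x ∂volume.restrict (Ioo 0 (Γ.length e)),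
        |M e x| ^ p + |m e x| ^ p = |g e x| ^ p + |h e x| ^ p := by
  obtain ⟨f₁, hf₁, hz₁⟩ := hu.2
  obtain ⟨f₂, hf₂, hz₂⟩ := hv.2
  choose M m h1 h2 h3 using fun e => (hu.1 e).max_min hp (Γ.length_pos e) (hv.1 e)
  refine ⟨M, m, ⟨h1, fun a => max (f₁ a) (f₂ a), fun e => ?_, fun a ha => ?_⟩,
    ⟨h2, fun a => min (f₁ a) (f₂ a), fun e => ?_, fun a ha => ?_⟩, h3⟩
  · simp [(hf₁ e).1, (hf₁ e).2, (hf₂ e).1, (hf₂ e).2]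
  · simp [hz₁ a ha, hz₂ a ha]
  · simp [(hf₁ e).1, (hf₁ e).2, (hf₂ e).1, (hf₂ e).2]
  · simp [hz₁ a ha, hz₂ a ha]

/-- The values of a function of class `C^1` on a single edge, vanishing at its ends. -/
theorem single [DecidableEq E] (e : E) {φ φ' : ℝ → ℝ} (hφ : ∀ x, HasDerivAt φ (φ' x) x)
    (hφ' : Continuous φ') (h0 : φ 0 = 0) (h1 : φ (Γ.length e) = 0) :
    Γ.IsGPrim p VD (Pi.single e φ) (Pi.single e φ') := by
  refine ⟨fun e' => ?_, fun _ => 0, fun e' => ?_, fun _ _ => rfl⟩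
  · rcases eq_or_ne e' e with rfl | hne
    · simpa using IsPrim.of_hasDerivAt hφ hφ'
    · rw [Pi.single_eq_of_ne hne, Pi.single_eq_of_ne hne]
      exact IsPrim.of_hasDerivAt (fun x => hasDerivAt_const x 0) continuous_const
  · rcases eq_or_ne e' e with rfl | hne
    · simp [h0, h1]
    · simp [Pi.single_eq_of_ne hne]

/-- The edgewise affine function with prescribed values at the vertices. -/
theorem affine {c : V → ℝ} (hc : ∀ a ∈ VD, c a = 0) :
    Γ.IsGPrim p VD
      (fun e x => c (Γ.init e) + (c (Γ.term e) - c (Γ.init e)) / Γ.length e * x)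
      (fun e _ => (c (Γ.term e) - c (Γ.init e)) / Γ.length e) := by
  refine ⟨fun e => IsPrim.of_hasDerivAt (fun x => ?_) continuous_const, c, fun e => ?_, hc⟩
  · simpa using ((hasDerivAt_id x).const_mul
      ((c (Γ.term e) - c (Γ.init e)) / Γ.length e)).const_add (c (Γ.init e))
  · have := (Γ.length_pos e).ne'
    constructor
    · simp
    · field_simp
      ring

end IsGPrim

theorem IsGPrim.integrableOn_abs_rpow (hp : 1 < p) (hu : Γ.IsGPrim p VD u g) (e : E) :
    IntegrableOn (fun x => |u e x| ^ p) (Ioo 0 (Γ.length e)) :=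
  (hu.continuousOn hp e).memLp_Ioo.integrable_abs_rpow hp

theorem IsGPrim.integrableOn_abs_rpow_deriv (hp : 1 < p) (hu : Γ.IsGPrim p VD u g) (e : E) :
    IntegrableOn (fun x => |g e x| ^ p) (Ioo 0 (Γ.length e)) :=
  (hu.1 e).1.integrable_abs_rpow hp

/-! ### The Rayleigh quotient, its minimizers and the Kirchhoff condition. -/

section Energy

variable [Fintype E]

/-- The `p`-th power of the `L^p` norm on the graph. -/
noncomputable def powerNorm (Γ : MetricGraph V E) (p : ℝ) (u : E → ℝ → ℝ) : ℝ :=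
  Γ.integral fun e x => |u e x| ^ p

theorem integral_congr_ae' {F G : E → ℝ → ℝ}
    (hFG : ∀ e, ∀ᵐ x ∂volume.restrict (Ioo 0 (Γ.length e)), F e x = G e x) :
    Γ.integral F = Γ.integral G :=
  Finset.sum_congr rfl fun e _ => integral_congr_ae (hFG e)

theorem integral_congr_Ioo {F G : E → ℝ → ℝ}
    (hFG : ∀ e, ∀ x ∈ Ioo 0 (Γ.length e), F e x = G e x) :
    Γ.integral F = Γ.integral G :=
  Finset.sum_congr rfl fun e _ => setIntegral_congr_fun measurableSet_Ioo (hFG e)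

theorem powerNorm_nonneg (u : E → ℝ → ℝ) : 0 ≤ Γ.powerNorm p u :=
  Finset.sum_nonneg fun _ _ => integral_nonneg fun _ => Real.rpow_nonneg (abs_nonneg _) _

theorem powerNorm_const_mul (c : ℝ) (u : E → ℝ → ℝ) :
    Γ.powerNorm p (fun e x => c * u e x) = |c| ^ p * Γ.powerNorm p u := by
  simp only [powerNorm, integral, Finset.mul_sum, ← integral_const_mul, abs_mul,
    Real.mul_rpow (abs_nonneg c) (abs_nonneg _)]

theorem powerNorm_add {u v u' v' : E → ℝ → ℝ}
    (hu : ∀ e, IntegrableOn (fun x => |u e x| ^ p) (Ioo 0 (Γ.length e)))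
    (hv : ∀ e, IntegrableOn (fun x => |v e x| ^ p) (Ioo 0 (Γ.length e)))
    (hu' : ∀ e, IntegrableOn (fun x => |u' e x| ^ p) (Ioo 0 (Γ.length e)))
    (hv' : ∀ e, IntegrableOn (fun x => |v' e x| ^ p) (Ioo 0 (Γ.length e)))
    (hE : ∀ e, ∀ᵐ x ∂volume.restrict (Ioo 0 (Γ.length e)),
        |u e x| ^ p + |v e x| ^ p = |u' e x| ^ p + |v' e x| ^ p) :
    Γ.powerNorm p u + Γ.powerNorm p v = Γ.powerNorm p u' + Γ.powerNorm p v' := by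
  simp only [powerNorm, integral]
  rw [← Finset.sum_add_distrib, ← Finset.sum_add_distrib]
  refine Finset.sum_congr rfl fun e _ => ?_
  rw [← integral_add (hu e) (hv e), ← integral_add (hu' e) (hv' e)]
  exact integral_congr_ae (hE e)

theorem IsGPrim.powerNorm_edgeDeriv (hp : 1 < p) (hu : Γ.IsGPrim p VD u g) :
    Γ.powerNorm p (Γ.edgeDeriv u) = Γ.powerNorm p g :=
  integral_congr_ae' fun e => (hu.edgeDeriv_ae_eq hp e).mono fun x hx => by rw [hx]

theorem IsGPrim.powerNorm_pos (hp : 1 < p) (hu : Γ.IsGPrim p VD u g) (hn : Γ.IsNontrivial u) :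
    0 < Γ.powerNorm p u := by
  obtain ⟨e, x, hx, hne⟩ := hn
  refine Finset.sum_pos' (fun _ _ => integral_nonneg fun _ => Real.rpow_nonneg (abs_nonneg _) _)
    ⟨e, Finset.mem_univ e, ?_⟩
  rw [setIntegral_Ioo_eq_intervalIntegral (Γ.length_pos e).le]
  exact intervalIntegral.integral_pos (Γ.length_pos e)
    ((hu.continuousOn hp e).abs.rpow_const fun _ _ => Or.inr (by linarith))
    (fun _ _ => Real.rpow_nonneg (abs_nonneg _) _)
    ⟨x, hx, Real.rpow_pos_of_pos (abs_pos.2 hne) _⟩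

theorem firstEigenvalue_nonneg (Γ : MetricGraph V E) (p : ℝ) (VD : Set V) :
    0 ≤ Γ.firstEigenvalue p VD := by
  refine Real.sInf_nonneg ?_
  rintro _ ⟨u, -, -, rfl⟩
  exact div_nonneg (powerNorm_nonneg _) (powerNorm_nonneg _)

/-- The product form also covers u = 0, so it applies to u + tw, to minima and to midpoints without
a nontriviality check. -/
theorem IsGPrim.firstEigenvalue_mul_le (hp : 1 < p) (hu : Γ.IsGPrim p VD u g) :
    Γ.firstEigenvalue p VD * Γ.powerNorm p u ≤ Γ.powerNorm p g := by
  by_cases hn : Γ.IsNontrivial u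
  · rw [← le_div_iff₀ (hu.powerNorm_pos hp hn), ← hu.powerNorm_edgeDeriv hp]
    refine csInf_le ⟨0, ?_⟩ ⟨u, hu.memX hp, hn, rfl⟩
    rintro _ ⟨u, -, -, rfl⟩
    exact div_nonneg (powerNorm_nonneg _) (powerNorm_nonneg _)
  · have : Γ.powerNorm p u = Γ.integral fun _ _ => 0 := by
      refine integral_congr_Ioo fun e x hx => ?_
      have : u e x = 0 := by
        by_contra hne
        exact hn ⟨e, x, Ioo_subset_Icc_self hx, hne⟩
      rw [this, abs_zero, Real.zero_rpow (by linarith)]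
    rw [this]
    simpa [integral] using powerNorm_nonneg g

/-- Allows any almost everywhere version of the derivative of the test function, so explicit test
functions can be used. -/
theorem IsEigenfunction.weak (hp : 1 < p) (hu : Γ.IsEigenfunction p VD lam u)
    (hw : Γ.IsGPrim p VD w h) :
    Γ.integral (fun e x => signedPow p (Γ.edgeDeriv u e x) * h e x) =
      lam * Γ.integral (fun e x => signedPow p (u e x) * w e x) := by
  refine Eq.trans ?_ (hu.2.2 w (hw.memX hp))
  exact integral_congr_ae' fun e => (hw.edgeDeriv_ae_eq hp e).mono fun x hx => by
    rw [hx]; rfl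

theorem IsEigenfunction.powerNorm_eq (hp : 1 < p) (hu : Γ.IsEigenfunction p VD lam u) :
    Γ.powerNorm p (Γ.edgeDeriv u) = lam * Γ.powerNorm p u := by
  have := hu.weak hp (hu.1.isGPrim hp)
  simp only [signedPow_mul_self hp] at this
  exact this

/-- Minimizers of the Rayleigh quotient are eigenfunctions. -/
theorem IsGPrim.isEigenfunction (hp : 1 < p) (hu : Γ.IsGPrim p VD u g) (hn : Γ.IsNontrivial u)
    (hmin : Γ.powerNorm p g = Γ.firstEigenvalue p VD * Γ.powerNorm p u) :
    Γ.IsEigenfunction p VD (Γ.firstEigenvalue p VD) u := by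
  refine ⟨hu.memX hp, hn, fun w hw => ?_⟩
  set lam := Γ.firstEigenvalue p VD with hlam
  have hw' := hw.isGPrim hp
  set h := Γ.edgeDeriv w
  have d1 : HasDerivAt (fun t : ℝ => Γ.powerNorm p fun e x => g e x + t * h e x)
      (∑ e, p * ∫ x in Ioo 0 (Γ.length e), signedPow p (g e x) * h e x) 0 :=
    HasDerivAt.fun_sum fun e _ => (hasDerivAt_integral_abs_rpow hp (hu.1 e).1 (hw'.1 e).1).2
  have d2 : HasDerivAt (fun t : ℝ => Γ.powerNorm p fun e x => u e x + t * w e x)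
      (∑ e, p * ∫ x in Ioo 0 (Γ.length e), signedPow p (u e x) * w e x) 0 :=
    HasDerivAt.fun_sum fun e _ => (hasDerivAt_integral_abs_rpow hp
      (hu.continuousOn hp e).memLp_Ioo (hw'.continuousOn hp e).memLp_Ioo).2
  have d3 := d1.sub (d2.const_mul lam)
  have hm : IsLocalMin ((fun t : ℝ => Γ.powerNorm p fun e x => g e x + t * h e x) -
      fun t : ℝ => lam * Γ.powerNorm p fun e x => u e x + t * w e x) 0 := by
    refine Filter.Eventually.of_forall fun t => ?_
    simp only [Pi.sub_apply, zero_mul, add_zero]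
    have := (hu.add hp (hw'.const_mul t)).firstEigenvalue_mul_le hp
    rw [hmin]
    linarith
  have key := hm.hasDerivAt_eq_zero d3
  rw [← Finset.mul_sum, ← Finset.mul_sum] at key
  have e1 : Γ.integral (fun e x => |Γ.edgeDeriv u e x| ^ (p - 2) * Γ.edgeDeriv u e x *
      Γ.edgeDeriv w e x) = Γ.integral fun e x => signedPow p (g e x) * h e x :=
    integral_congr_ae' fun e => (hu.edgeDeriv_ae_eq hp e).mono fun x hx => by
      rw [hx]; rfl
  rw [e1]
  have hp0 : p ≠ 0 := by linarith
  refine mul_left_cancel₀ hp0 ?_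
  have e2 : ∀ a b : ℝ, p * a - lam * (p * b) = 0 → p * a = p * (lam * b) := by
    intro a b hab; linarith
  exact e2 _ _ key

/-- Edgewise integral form of the eigenvalue equation, with the Kirchhoff condition. -/
theorem IsEigenfunction.exists_flux (h : p.HolderConjugate r)
    (hu : Γ.IsEigenfunction p VD lam u) :
    ∃ C : E → ℝ, (∀ e, ∀ x ∈ Icc 0 (Γ.length e),
        u e x = u e 0 + ∫ t in (0 : ℝ)..x, signedPow r (flux p lam (C e) (u e) t)) ∧
      ∀ c : V → ℝ, (∀ a ∈ VD, c a = 0) →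
        ∑ e, (flux p lam (C e) (u e) (Γ.length e) * c (Γ.term e) -
          flux p lam (C e) (u e) 0 * c (Γ.init e)) = 0 := by
  classical
  have hp := h.lt
  have hG := hu.1.isGPrim hp
  have H : ∀ e, ∃ C, ∀ᵐ x ∂volume.restrict (Ioo 0 (Γ.length e)),
      signedPow p (Γ.edgeDeriv u e x) = flux p lam C (u e) x := by
    intro e
    refine (hG.1 e).exists_flux hp (Γ.length_pos e) fun φ hφ hφC hφS => ?_
    -- A test function living on one edge isolates the equation on that edge.
    have hw : Γ.IsGPrim p VD (Pi.single e φ) (Pi.single e (deriv φ)) :=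
      IsGPrim.single e (fun x => ((hφ.differentiable (by simp)) x).hasDerivAt)
        (hφ.continuous_deriv (by simp))
        (image_eq_zero_of_notMem_tsupport fun h => by simpa using hφS h)
        (image_eq_zero_of_notMem_tsupport fun h => by simpa using hφS h)
    have key := hu.weak hp hw
    simp only [integral] at key
    rw [Finset.sum_eq_single e, Finset.sum_eq_single e] at key
    · simpa using key
    · intro e' _ hne; simp [Pi.single_eq_of_ne hne]
    · simp
    · intro e' _ hne; simp [Pi.single_eq_of_ne hne]
    · simp
  choose C hC using H
  refine ⟨C, fun e => (hG.1 e).of_flux h (hC e), fun c hc => ?_⟩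
  -- Edgewise affine test functions leave only boundary fluxes, which yields the balance at the
  -- vertices.
  have key := hu.weak hp (IsGPrim.affine (Γ := Γ) (p := p) hc)
  rw [← sub_eq_zero] at key
  simp only [integral, Finset.mul_sum, ← Finset.sum_sub_distrib] at key
  refine (Finset.sum_congr rfl fun e _ => ?_).trans key
  have hl := Γ.length_pos e
  have e1 := integral_flux_affine hp hl (hG.continuousOn hp e) lam (C e) (c (Γ.init e))
    ((c (Γ.term e) - c (Γ.init e)) / Γ.length e)
  rw [div_mul_cancel₀ _ hl.ne', add_sub_cancel] at e1
  rw [← e1]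
  congr 1
  exact integral_congr_ae ((hC e).mono fun x hx => by simp only; rw [hx])

end Energy

end MetricGraph

/-! ### Propagation from edge to edge. -/

namespace MetricGraph

variable {V E : Type*} {Γ : MetricGraph V E} {p lam : ℝ} {VD : Set V} {u v g : E → ℝ → ℝ}

/-- The vertex `a` is an end of the edge `e`. -/
def Inc (Γ : MetricGraph V E) (e : E) (a : V) : Prop := Γ.init e = a ∨ Γ.term e = a

theorem Inc.adj {e : E} {a : V} (h : Γ.Inc e a) : ∃ b, Γ.Adj b a ∧ Γ.Inc e b := by
  rcases h with h | h
  · exact ⟨Γ.term e, ⟨e, Or.inr ⟨h, rfl⟩⟩, Or.inr rfl⟩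
  · exact ⟨Γ.init e, ⟨e, Or.inl ⟨rfl, h⟩⟩, Or.inl rfl⟩

/-- A property of edges that passes between edges sharing a vertex outside `VD` holds for all edges
once it holds for one. -/
theorem forall_edge_of_exists [Fintype E] (hconn : Γ.Connected)
    (hterm : ∀ v ∈ VD, Γ.IsTerminal v) (hdeg : VD = Set.univ → Fintype.card E = 1) {Q : E → Prop}
    (hQ : ∀ e e' a, a ∉ VD → Γ.Inc e a → Γ.Inc e' a → Q e → Q e') {e₀ : E} (h₀ : Q e₀) (e : E) :
    Q e := by
  have key : ∀ b, Relation.ReflTransGen Γ.Adj (Γ.init e₀) b → ∃ e, Γ.Inc e b ∧ Q e := by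
    intro b hb
    induction hb with
    | refl => exact ⟨e₀, Or.inl rfl, h₀⟩
    | @tail a b _ hab ih =>
      obtain ⟨e₁, hi, hq⟩ := ih
      by_cases ha : a ∈ VD
      -- At a terminal vertex a the path can only continue to the other end of the edge already
      -- reached, so no transfer through a is needed.
      · obtain ⟨c, hc, hic⟩ := hi.adj
        have hba : Γ.Adj b a := by
          obtain ⟨e', he'⟩ := hab
          exact ⟨e', he'.symm⟩
        have : c = b := (hterm a ha).unique hc hba
        exact ⟨e₁, this ▸ hic, hq⟩
      · obtain ⟨e', he' | he'⟩ := hab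
        · exact ⟨e', Or.inr he'.2, hQ _ _ a ha hi (Or.inl he'.1) hq⟩
        · exact ⟨e', Or.inl he'.1, hQ _ _ a ha hi (Or.inr he'.2) hq⟩
  by_cases h1 : Γ.init e ∈ VD
  · by_cases h2 : Γ.term e ∈ VD
    -- If both ends of e are terminal, each is adjacent only to the other (or to itself, for a
    -- loop), so they exhaust the graph. Then `VD` is everything and `hdeg` leaves a single edge.
    · have hall : ∀ b, Relation.ReflTransGen Γ.Adj (Γ.init e) b → b = Γ.init e ∨ b = Γ.term e := by
        intro b hb
        induction hb with
        | refl => exact Or.inl rfl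
        | @tail a b _ hab ih =>
          have hba : Γ.Adj b a := by
            obtain ⟨e', he'⟩ := hab
            exact ⟨e', he'.symm⟩
          rcases ih with rfl | rfl
          · exact Or.inr ((hterm _ h1).unique hba ⟨e, Or.inr ⟨rfl, rfl⟩⟩)
          · exact Or.inl ((hterm _ h2).unique hba ⟨e, Or.inl ⟨rfl, rfl⟩⟩)
      have huniv : VD = univ := eq_univ_of_forall fun b => by
        rcases hall b (hconn _ _) with rfl | rfl <;> assumption
      obtain ⟨e₁, he₁⟩ := Fintype.card_eq_one_iff.1 (hdeg huniv)
      rw [he₁ e, ← he₁ e₀]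
      exact h₀
    · obtain ⟨e', hi, hq⟩ := key _ (hconn (Γ.init e₀) (Γ.term e))
      exact hQ _ _ _ h2 hi (Or.inr rfl) hq
  · obtain ⟨e', hi, hq⟩ := key _ (hconn (Γ.init e₀) (Γ.init e))
    exact hQ _ _ _ h1 hi (Or.inl rfl) hq

/-- The points of the edge `e` that are not vertices in `S`. -/
def freePart (Γ : MetricGraph V E) (S : Set V) (e : E) : Set ℝ :=
  {x ∈ Icc 0 (Γ.length e) | ¬ Γ.IsVertexIn S e x}

theorem Ioo_subset_freePart (Γ : MetricGraph V E) (S : Set V) (e : E) :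
    Ioo 0 (Γ.length e) ⊆ Γ.freePart S e := fun x hx =>
  ⟨Ioo_subset_Icc_self hx, by
    rintro (h | h)
    · exact hx.1.ne' h.1
    · exact hx.2.ne h.1⟩

theorem zero_mem_freePart {S : Set V} {e : E} (h : Γ.init e ∉ S) : 0 ∈ Γ.freePart S e :=
  ⟨left_mem_Icc.2 (Γ.length_pos e).le, by
    rintro (h' | h')
    · exact h h'.2
    · exact (Γ.length_pos e).ne h'.1⟩

theorem length_mem_freePart {S : Set V} {e : E} (h : Γ.term e ∉ S) :
    Γ.length e ∈ Γ.freePart S e :=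
  ⟨right_mem_Icc.2 (Γ.length_pos e).le, by
    rintro (h' | h')
    · exact (Γ.length_pos e).ne' h'.1
    · exact h h'.2⟩

theorem isPreconnected_freePart (Γ : MetricGraph V E) (S : Set V) (e : E) :
    IsPreconnected (Γ.freePart S e) := by
  refine isPreconnected_Ioo.subset_closure (Γ.Ioo_subset_freePart S e) ?_
  rw [closure_Ioo (Γ.length_pos e).ne]
  exact sep_subset _ _

/-- A vertex value is taken at a free point of every incident edge. -/
theorem Inc.exists_mem_freePart {e : E} {a : V} (hi : Γ.Inc e a) (ha : a ∉ VD) :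
    ∃ x ∈ Γ.freePart VD e, ∀ (u : E → ℝ → ℝ) (f : V → ℝ),
      (∀ e, u e 0 = f (Γ.init e) ∧ u e (Γ.length e) = f (Γ.term e)) → u e x = f a := by
  rcases hi with rfl | rfl
  · exact ⟨0, zero_mem_freePart ha, fun u f hf => (hf e).1⟩
  · exact ⟨_, length_mem_freePart ha, fun u f hf => (hf e).2⟩

/-! ### Strict sign of first eigenfunctions. -/

variable [Fintype E]

/-- The strong maximum principle. -/
theorem IsEigenfunction.pos_of_nonneg (hconn : Γ.Connected) (hp : 1 < p)
    (hterm : ∀ v ∈ VD, Γ.IsTerminal v) (hdeg : VD = Set.univ → Fintype.card E = 1)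
    (hlam : 0 ≤ lam) (hu : Γ.IsEigenfunction p VD lam u)
    (hpos : ∀ e, ∀ x ∈ Icc 0 (Γ.length e), 0 ≤ u e x) (e : E) {x : ℝ}
    (hx : x ∈ Γ.freePart VD e) : 0 < u e x := by
  classical
  have hpr := Real.HolderConjugate.conjExponent hp
  set r := p.conjExponent
  have hr : 1 < r := hpr.symm.lt
  have hG := hu.1.isGPrim hp
  obtain ⟨C, hC, hK⟩ := hu.exists_flux hpr
  obtain ⟨f, hf, hz⟩ := hG.2
  have hc := fun e => hG.continuousOn hp e
  have vertex : ∀ a, a ∉ VD → f a = 0 → ∀ e, Γ.Inc e a → ∀ x ∈ Icc 0 (Γ.length e), u e x = 0 := by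
    intro a ha hfa e hi
    have hl := Γ.length_pos e
    have h1 : ∀ e, flux p lam (C e) (u e) (Γ.length e) *
        (Pi.single a 1 : V → ℝ) (Γ.term e) ≤ 0 := by
      intro e
      by_cases h : Γ.term e = a
      · rw [h, Pi.single_eq_same, mul_one]
        exact flux_nonpos_of_zero hp hr hlam (Γ.length_pos e) (hc e) (hpos e) (hC e)
          (right_mem_Ioc.2 (Γ.length_pos e)) (by rw [(hf e).2, h, hfa])
      · rw [Pi.single_eq_of_ne h, mul_zero]
    have h2 : ∀ e, 0 ≤ flux p lam (C e) (u e) 0 * (Pi.single a 1 : V → ℝ) (Γ.init e) := by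
      intro e
      by_cases h : Γ.init e = a
      · rw [h, Pi.single_eq_same, mul_one]
        exact flux_nonneg_of_zero hp hr hlam (Γ.length_pos e) (hc e) (hpos e) (hC e)
          (left_mem_Ico.2 (Γ.length_pos e)) (by rw [(hf e).1, h, hfa])
      · rw [Pi.single_eq_of_ne h, mul_zero]
    -- Kirchhoff's condition at a. Each summand is nonpositive, so each vanishes; a loop contributes
    -- two terms of the same sign, and both vanish.
    have key := hK (Pi.single a 1) fun b hb => Pi.single_eq_of_ne (by rintro rfl; exact ha hb) _
    rw [Finset.sum_eq_zero_iff_of_nonpos fun e _ => by linarith [h1 e, h2 e]] at key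
    have key := key e (Finset.mem_univ e)
    rcases hi with h | h
    · refine eq_zero_of_flux_eq_zero hp hr hlam hl (hc e) (hpos e) (hC e) (left_mem_Icc.2 hl.le)
        (by rw [(hf e).1, h, hfa]) ?_
      have h1 := h1 e
      have h2 := h2 e
      simp only [h, Pi.single_eq_same, mul_one] at *
      linarith
    · refine eq_zero_of_flux_eq_zero hp hr hlam hl (hc e) (hpos e) (hC e) (right_mem_Icc.2 hl.le)
        (by rw [(hf e).2, h, hfa]) ?_
      have h1 := h1 e
      have h2 := h2 e
      simp only [h, Pi.single_eq_same, mul_one] at *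
      linarith
  refine lt_of_le_of_ne (hpos e x hx.1) fun hux => ?_
  have hQ : ∀ y ∈ Icc 0 (Γ.length e), u e y = 0 := by
    rcases hx.1.1.eq_or_lt with h0 | h0
    · subst h0
      exact vertex (Γ.init e) (fun h => hx.2 (Or.inl ⟨rfl, h⟩)) (by rw [← (hf e).1, ← hux]) e
        (Or.inl rfl)
    rcases hx.1.2.eq_or_lt with h1 | h1
    · subst h1
      exact vertex (Γ.term e) (fun h => hx.2 (Or.inr ⟨rfl, h⟩)) (by rw [← (hf e).2, ← hux]) e
        (Or.inr rfl)
    refine eq_zero_of_flux_eq_zero hp hr hlam (Γ.length_pos e) (hc e) (hpos e) (hC e) hx.1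
      hux.symm (le_antisymm ?_ ?_)
    · exact flux_nonpos_of_zero hp hr hlam (Γ.length_pos e) (hc e) (hpos e) (hC e) ⟨h0, h1.le⟩
        hux.symm
    · exact flux_nonneg_of_zero hp hr hlam (Γ.length_pos e) (hc e) (hpos e) (hC e) ⟨h0.le, h1⟩
        hux.symm
  obtain ⟨e₁, x₁, hx₁, hne⟩ := hu.2.1
  refine hne (forall_edge_of_exists hconn hterm hdeg
    (Q := fun e => ∀ y ∈ Icc 0 (Γ.length e), u e y = 0) ?_ hQ e₁ x₁ hx₁)
  intro e e' a ha hi hi' hq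
  obtain ⟨y, hy, hy'⟩ := hi.exists_mem_freePart ha
  exact vertex a ha (by rw [← hy' u f hf]; exact hq y hy.1) e' hi'

/-- The modulus of a first eigenfunction is a first eigenfunction. -/
theorem IsEigenfunction.abs (hp : 1 < p)
    (hu : Γ.IsEigenfunction p VD (Γ.firstEigenvalue p VD) u) :
    Γ.IsEigenfunction p VD (Γ.firstEigenvalue p VD) fun e x => |u e x| := by
  obtain ⟨g', hg', hE⟩ := (hu.1.isGPrim hp).abs hp
  refine hg'.isEigenfunction hp ?_ ?_
  · obtain ⟨e, x, hx, hne⟩ := hu.2.1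
    exact ⟨e, x, hx, abs_ne_zero.2 hne⟩
  · have e1 : Γ.powerNorm p g' = Γ.powerNorm p (Γ.edgeDeriv u) :=
      integral_congr_ae' fun e => (hE e).mono fun x hx => by rw [hx]
    rw [e1, hu.powerNorm_eq hp]
    simp [powerNorm]

theorem IsEigenfunction.const_mul (hp : 1 < p)
    (hu : Γ.IsEigenfunction p VD (Γ.firstEigenvalue p VD) u) {c : ℝ} (hc : c ≠ 0) :
    Γ.IsEigenfunction p VD (Γ.firstEigenvalue p VD) fun e x => c * u e x := by
  refine ((hu.1.isGPrim hp).const_mul c).isEigenfunction hp ?_ ?_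
  · obtain ⟨e, x, hx, hne⟩ := hu.2.1
    exact ⟨e, x, hx, mul_ne_zero hc hne⟩
  · rw [powerNorm_const_mul, powerNorm_const_mul, hu.powerNorm_eq hp]
    ring

/-- First eigenfunctions have a strict sign. -/
theorem IsEigenfunction.pos_or_neg (hconn : Γ.Connected) (hp : 1 < p)
    (hterm : ∀ v ∈ VD, Γ.IsTerminal v) (hdeg : VD = Set.univ → Fintype.card E = 1)
    (hu : Γ.IsEigenfunction p VD (Γ.firstEigenvalue p VD) u) :
    (∀ e, ∀ x ∈ Γ.freePart VD e, 0 < u e x) ∨ (∀ e, ∀ x ∈ Γ.freePart VD e, u e x < 0) := by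
  -- The maximum principle applied to |u|. With no zeros left, the intermediate value theorem fixes
  -- the sign on each edge.
  have hne : ∀ e, ∀ x ∈ Γ.freePart VD e, u e x ≠ 0 := fun e x hx =>
    abs_pos.1 ((hu.abs hp).pos_of_nonneg hconn hp hterm hdeg (Γ.firstEigenvalue_nonneg p VD)
      (fun _ _ _ => abs_nonneg _) e hx)
  have hG := hu.1.isGPrim hp
  obtain ⟨f, hf, -⟩ := hG.2
  have dich : ∀ e, ∀ x ∈ Γ.freePart VD e, ∀ y ∈ Γ.freePart VD e, 0 < u e x → 0 < u e y := by
    intro e x hx y hy h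
    by_contra! h'
    obtain ⟨z, hz, hz'⟩ := (Γ.isPreconnected_freePart VD e).intermediate_value hy hx
      ((hG.continuousOn hp e).mono (sep_subset _ _)) ⟨h', h.le⟩
    exact hne e z hz hz'
  by_cases H : ∃ e, ∃ x ∈ Γ.freePart VD e, 0 < u e x
  · left
    obtain ⟨e₀, x₀, hx₀, h₀⟩ := H
    refine forall_edge_of_exists hconn hterm hdeg (Q := fun e => ∀ x ∈ Γ.freePart VD e, 0 < u e x)
      ?_ (fun y hy => dich e₀ x₀ hx₀ y hy h₀)
    intro e e' a ha hi hi' hq y hy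
    obtain ⟨x, hx, hx'⟩ := hi.exists_mem_freePart ha
    obtain ⟨z, hz, hz'⟩ := hi'.exists_mem_freePart ha
    refine dich e' z hz y hy ?_
    rw [hz' u f hf, ← hx' u f hf]
    exact hq x hx
  · right
    push Not at H
    exact fun e x hx => lt_of_le_of_ne (H e x hx) (hne e x hx)

/-! ### Simplicity. -/

/-- The maximum of two first eigenfunctions is a first eigenfunction, if it does not vanish. -/
theorem IsEigenfunction.sup (hp : 1 < p)
    (hu : Γ.IsEigenfunction p VD (Γ.firstEigenvalue p VD) u)
    (hv : Γ.IsEigenfunction p VD (Γ.firstEigenvalue p VD) v)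
    (hn : Γ.IsNontrivial fun e x => max (u e x) (v e x)) :
    Γ.IsEigenfunction p VD (Γ.firstEigenvalue p VD) fun e x => max (u e x) (v e x) := by
  have hu' := hu.1.isGPrim hp
  have hv' := hv.1.isGPrim hp
  obtain ⟨M, m, hM, hm, hE⟩ := hu'.max_min hp hv'
  refine hM.isEigenfunction hp hn (le_antisymm ?_ (hM.firstEigenvalue_mul_le hp))
  -- E and N have the same totals over {max, min} as over {u, v}, and E - λ₁N is nonnegative on both
  -- max and min, so it is zero on each.
  have e1 := powerNorm_add (hM.integrableOn_abs_rpow_deriv hp)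
    (hm.integrableOn_abs_rpow_deriv hp) (hu'.integrableOn_abs_rpow_deriv hp)
    (hv'.integrableOn_abs_rpow_deriv hp) hE
  have e2 := powerNorm_add (hM.integrableOn_abs_rpow hp)
    (hm.integrableOn_abs_rpow hp) (hu'.integrableOn_abs_rpow hp)
    (hv'.integrableOn_abs_rpow hp) (fun e => Filter.Eventually.of_forall fun x => by
      rcases le_total (u e x) (v e x) with h | h
      · rw [max_eq_right h, min_eq_left h, add_comm]
      · rw [max_eq_left h, min_eq_right h])
  have e3 := hm.firstEigenvalue_mul_le hp
  rw [hu.powerNorm_eq hp, hv.powerNorm_eq hp, ← mul_add, ← e2] at e1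
  linarith

/-- Holds at every interior point, not merely almost everywhere; applied to a maximum of two
eigenfunctions, it rules out corners. -/
theorem IsEigenfunction.differentiableAt (hp : 1 < p) (hu : Γ.IsEigenfunction p VD lam u) {e : E}
    {x : ℝ} (hx : x ∈ Ioo 0 (Γ.length e)) : DifferentiableAt ℝ (u e) x := by
  have hpr := Real.HolderConjugate.conjExponent hp
  obtain ⟨C, hC, -⟩ := hu.exists_flux hpr
  exact (hasDerivAt_of_flux hp hpr.symm.lt (Γ.length_pos e)
    ((hu.1.isGPrim hp).continuousOn hp e) (hC e) hx).differentiableAt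

/-- Positive first eigenfunctions are proportional on every edge. -/
theorem IsEigenfunction.exists_edge_const (hp : 1 < p)
    (hu : Γ.IsEigenfunction p VD (Γ.firstEigenvalue p VD) u)
    (hv : Γ.IsEigenfunction p VD (Γ.firstEigenvalue p VD) v)
    (hu0 : ∀ e, ∀ x ∈ Γ.freePart VD e, 0 < u e x)
    (hv0 : ∀ e, ∀ x ∈ Γ.freePart VD e, 0 < v e x) (e : E) :
    ∃ c, 0 < c ∧ ∀ x ∈ Icc 0 (Γ.length e), v e x = c * u e x := by
  have hl := Γ.length_pos e
  have hu1 : ∀ x ∈ Ioo 0 (Γ.length e), 0 < u e x := fun x hx =>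
    hu0 e x (Γ.Ioo_subset_freePart VD e hx)
  have hv1 : ∀ x ∈ Ioo 0 (Γ.length e), 0 < v e x := fun x hx =>
    hv0 e x (Γ.Ioo_subset_freePart VD e hx)
  have key : ∀ x ∈ Ioo 0 (Γ.length e), HasDerivAt (fun y => v e y / u e y) 0 x := by
    intro x hx
    have hux := hu1 x hx
    -- Chosen so that cu and v meet at x. Their maximum lies above both with equality at x, so its
    -- derivative there equals both of theirs.
    set c := v e x / u e x with hc
    have hcpos : 0 < c := div_pos (hv1 x hx) hux
    have hcx : c * u e x = v e x := div_mul_cancel₀ _ hux.ne'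
    have hM := (hu.const_mul hp hcpos.ne').sup hp hv
      ⟨e, x, Ioo_subset_Icc_self hx, by simp [hcx, (hv1 x hx).ne']⟩
    have d1 := (hu.differentiableAt hp hx).hasDerivAt
    have d2 := (hv.differentiableAt hp hx).hasDerivAt
    have d3 := (hM.differentiableAt hp hx).hasDerivAt
    have e1 := IsLocalMin.hasDerivAt_eq_zero (a := x)
      (f := fun y => max (c * u e y) (v e y) - c * u e y)
      (Filter.Eventually.of_forall fun y => by simp [hcx]) (d3.sub (d1.const_mul c))
    have e2 := IsLocalMin.hasDerivAt_eq_zero (a := x)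
      (f := fun y => max (c * u e y) (v e y) - v e y)
      (Filter.Eventually.of_forall fun y => by simp [hcx]) (d3.sub d2)
    have e3 : deriv (v e) x = c * deriv (u e) x := by linarith
    have := d2.fun_div d1 hux.ne'
    have e4 : deriv (v e) x * u e x - v e x * deriv (u e) x = 0 := by
      rw [e3]
      linear_combination deriv (u e) x * hcx
    rwa [e4, zero_div] at this
  have hmid : Γ.length e / 2 ∈ Ioo 0 (Γ.length e) := ⟨by linarith, by linarith⟩
  set c := v e (Γ.length e / 2) / u e (Γ.length e / 2) with hc
  have hconst : ∀ x ∈ Ioo 0 (Γ.length e), v e x / u e x = c := fun x hx =>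
    isOpen_Ioo.is_const_of_deriv_eq_zero isPreconnected_Ioo
      (fun y hy => (key y hy).differentiableAt.differentiableWithinAt)
      (fun y hy => (key y hy).deriv) hx hmid
  have heq : EqOn (v e) (fun x => c * u e x) (Ioo 0 (Γ.length e)) := fun x hx => by
    simp only [← hconst x hx]
    rw [div_mul_cancel₀ _ (hu1 x hx).ne']
  refine ⟨c, div_pos (hv1 _ hmid) (hu1 _ hmid), ?_⟩
  exact heq.of_subset_closure ((hv.1.isGPrim hp).continuousOn hp e)
    (((hu.1.isGPrim hp).continuousOn hp e).const_mul c) Ioo_subset_Icc_self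
    (by rw [closure_Ioo hl.ne])

/-- Positive first eigenfunctions are proportional. -/
theorem IsEigenfunction.exists_const (hconn : Γ.Connected) (hp : 1 < p)
    (hterm : ∀ v ∈ VD, Γ.IsTerminal v) (hdeg : VD = Set.univ → Fintype.card E = 1)
    (hu : Γ.IsEigenfunction p VD (Γ.firstEigenvalue p VD) u)
    (hv : Γ.IsEigenfunction p VD (Γ.firstEigenvalue p VD) v)
    (hu0 : ∀ e, ∀ x ∈ Γ.freePart VD e, 0 < u e x)
    (hv0 : ∀ e, ∀ x ∈ Γ.freePart VD e, 0 < v e x) :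
    ∃ c, 0 < c ∧ ∀ e, ∀ x ∈ Icc 0 (Γ.length e), v e x = c * u e x := by
  obtain ⟨f, hf, -⟩ := (hu.1.isGPrim hp).2
  obtain ⟨k, hk, -⟩ := (hv.1.isGPrim hp).2
  choose c hc hcu using hu.exists_edge_const hp hv hu0 hv0
  obtain ⟨e₀, -⟩ := hu.2.1
  refine ⟨c e₀, hc e₀, forall_edge_of_exists hconn hterm hdeg
    (Q := fun e => ∀ x ∈ Icc 0 (Γ.length e), v e x = c e₀ * u e x) ?_ (hcu e₀)⟩
  intro e e' a ha hi hi' hq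
  obtain ⟨x, hx, hx'⟩ := hi.exists_mem_freePart ha
  obtain ⟨z, hz, hz'⟩ := hi'.exists_mem_freePart ha
  have h1 := hq x hx.1
  have h2 := hcu e' z hz.1
  have h3 := hu0 e' z hz
  rw [hx' u f hf, hx' v k hk] at h1
  rw [hz' u f hf, hz' v k hk] at h2
  rw [hz' u f hf] at h3
  -- Both constants relate the values of u and v at the shared vertex, where u is positive.
  have : c e' = c e₀ := mul_right_cancel₀ h3.ne' (h2.symm.trans h1)
  rw [← this]
  exact hcu e'

/-- A first eigenfunction is a sign times its modulus. -/
theorem IsEigenfunction.exists_sign (hconn : Γ.Connected) (hp : 1 < p)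
    (hterm : ∀ v ∈ VD, Γ.IsTerminal v) (hdeg : VD = Set.univ → Fintype.card E = 1)
    (hu : Γ.IsEigenfunction p VD (Γ.firstEigenvalue p VD) u) :
    ∃ s : ℝ, s * s = 1 ∧ ∀ e, ∀ x ∈ Icc 0 (Γ.length e), |u e x| = s * u e x := by
  have hz : ∀ e, ∀ x ∈ Icc 0 (Γ.length e), Γ.IsVertexIn VD e x → u e x = 0 := hu.1.2.2
  rcases hu.pos_or_neg hconn hp hterm hdeg with h | h
  · refine ⟨1, by norm_num, fun e x hx => ?_⟩
    by_cases hv : Γ.IsVertexIn VD e x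
    · simp [hz e x hx hv]
    · rw [abs_of_pos (h e x ⟨hx, hv⟩), one_mul]
  · refine ⟨-1, by norm_num, fun e x hx => ?_⟩
    by_cases hv : Γ.IsVertexIn VD e x
    · simp [hz e x hx hv]
    · rw [abs_of_neg (h e x ⟨hx, hv⟩), neg_one_mul]

/-- Any two first eigenfunctions are multiples of each other. -/
theorem IsEigenfunction.eq_const_mul (hconn : Γ.Connected) (hp : 1 < p)
    (hterm : ∀ v ∈ VD, Γ.IsTerminal v) (hdeg : VD = Set.univ → Fintype.card E = 1)
    (hu : Γ.IsEigenfunction p VD (Γ.firstEigenvalue p VD) u)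
    (hv : Γ.IsEigenfunction p VD (Γ.firstEigenvalue p VD) v) :
    ∃ c : ℝ, c ≠ 0 ∧ ∀ e, ∀ x ∈ Icc 0 (Γ.length e), v e x = c * u e x := by
  have hlam := Γ.firstEigenvalue_nonneg p VD
  obtain ⟨c, hc, hcu⟩ := (hu.abs hp).exists_const hconn hp hterm hdeg (hv.abs hp)
    (fun e x hx => (hu.abs hp).pos_of_nonneg hconn hp hterm hdeg hlam
      (fun _ _ _ => abs_nonneg _) e hx)
    (fun e x hx => (hv.abs hp).pos_of_nonneg hconn hp hterm hdeg hlam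
      (fun _ _ _ => abs_nonneg _) e hx)
  obtain ⟨s, hs, hsu⟩ := hu.exists_sign hconn hp hterm hdeg
  obtain ⟨t, ht, htv⟩ := hv.exists_sign hconn hp hterm hdeg
  have hs0 : s ≠ 0 := by rintro rfl; norm_num at hs
  have ht0 : t ≠ 0 := by rintro rfl; norm_num at ht
  -- With |u| = su, |v| = tv and t² = 1: v = t|v| = tc|u| = tcs u.
  refine ⟨t * c * s, by positivity, fun e x hx => ?_⟩
  have := hcu e x hx
  rw [hsu e x hx, htv e x hx] at this
  linear_combination t * this - v e x * ht

end MetricGraph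

/-! ### Pointwise inequalities for |·|^p. -/

open Filter Topology

section Pointwise

variable {p : ℝ}

/-- If |a| ≠ |b|, strict convexity of s^p on s ≥ 0 suffices; otherwise a = -b ≠ 0 and the midpoint
is 0. -/
theorem abs_half_add_rpow_lt (hp : 1 < p) {a b : ℝ} (hab : a ≠ b) :
    |(a + b) / 2| ^ p < (|a| ^ p + |b| ^ p) / 2 := by
  have h1 : |(a + b) / 2| ≤ (|a| + |b|) / 2 := by
    rw [abs_div, abs_two]
    gcongr
    exact abs_add_le a b
  rcases eq_or_ne |a| |b| with h | h
  · have hba : a = -b := (abs_eq_abs.1 h).resolve_left hab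
    have hb : b ≠ 0 := by
      rintro rfl
      simp at hba
      exact hab hba
    have e : (a + b) / 2 = 0 := by rw [hba]; ring
    rw [e, abs_zero, Real.zero_rpow (by linarith), h]
    have := Real.rpow_pos_of_pos (abs_pos.2 hb) p
    linarith
  · have h2 := (strictConvexOn_rpow hp).2 (abs_nonneg a) (abs_nonneg b) h
      (by norm_num : (0 : ℝ) < 1 / 2) (by norm_num : (0 : ℝ) < 1 / 2) (by norm_num)
    simp only [smul_eq_mul] at h2
    calc |(a + b) / 2| ^ p ≤ ((|a| + |b|) / 2) ^ p :=
          Real.rpow_le_rpow (abs_nonneg _) h1 (by linarith)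
      _ = (1 / 2 * |a| + 1 / 2 * |b|) ^ p := by ring_nf
      _ < 1 / 2 * |a| ^ p + 1 / 2 * |b| ^ p := h2
      _ = (|a| ^ p + |b| ^ p) / 2 := by ring

theorem abs_half_add_rpow_le (hp : 1 < p) (a b : ℝ) :
    |(a + b) / 2| ^ p ≤ (|a| ^ p + |b| ^ p) / 2 := by
  rcases eq_or_ne a b with rfl | h
  · simp
  · exact (abs_half_add_rpow_lt hp h).le

/-- Quantitative strict convexity of `|·|^p`. -/
theorem exists_abs_sub_rpow_le (hp : 1 < p) {ε : ℝ} (hε : 0 < ε) :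
    ∃ C, 0 ≤ C ∧ ∀ a b : ℝ, |a - b| ^ p ≤
      ε * (|a| ^ p + |b| ^ p) + C * ((|a| ^ p + |b| ^ p) / 2 - |(a + b) / 2| ^ p) := by
  have hp0 : 0 ≤ p := by linarith
  have hcont : ∀ f : ℝ × ℝ → ℝ, Continuous f → Continuous fun z => |f z| ^ p := fun f hf =>
    hf.abs.rpow_const fun _ => Or.inr hp0
  -- On this compact set the convexity deficit is positive, hence at least some δ > 0. There |a -
  -- b|^p ≤ 2^p, which explains the constant 2^p/δ; off it the ε-term suffices once |a|^p + |b|^p ≥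
  -- 1.
  let K : Set (ℝ × ℝ) := (Icc (-1) 1 ×ˢ Icc (-1) 1) ∩ {z | ε ≤ |z.1 - z.2| ^ p}
  have hK : IsCompact K := (isCompact_Icc.prod isCompact_Icc).inter_right
    (isClosed_le continuous_const (hcont _ (by fun_prop)))
  obtain ⟨δ, hδ, hmin⟩ := hK.exists_forall_le' (a := 0)
    (f := fun z : ℝ × ℝ => (|z.1| ^ p + |z.2| ^ p) / 2 - |(z.1 + z.2) / 2| ^ p)
    (((((hcont _ continuous_fst).add (hcont _ continuous_snd)).div_const 2).sub
      (hcont (fun z => (z.1 + z.2) / 2) (by fun_prop))).continuousOn) (by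
      rintro ⟨a, b⟩ ⟨-, hz⟩
      refine sub_pos.2 (abs_half_add_rpow_lt hp ?_)
      intro hab
      simp only at hab
      subst hab
      simp only [sub_self, abs_zero, mem_ofPred_eq] at hz
      rw [Real.zero_rpow (by linarith)] at hz
      linarith)
  refine ⟨2 ^ p / δ, by positivity, ?_⟩
  have unit : ∀ a b : ℝ, |a| ≤ 1 → |b| ≤ 1 → 1 ≤ |a| ^ p + |b| ^ p → |a - b| ^ p ≤
      ε * (|a| ^ p + |b| ^ p) + 2 ^ p / δ * ((|a| ^ p + |b| ^ p) / 2 - |(a + b) / 2| ^ p) := by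
    intro a b ha hb h1
    have hD := sub_nonneg.2 (abs_half_add_rpow_le hp a b)
    have hC : 0 ≤ 2 ^ p / δ := by positivity
    by_cases h : ε ≤ |a - b| ^ p
    · have h2 : |a - b| ^ p ≤ 2 ^ p :=
        Real.rpow_le_rpow (abs_nonneg _) ((abs_sub _ _).trans (by linarith)) hp0
      have h3 := hmin (a, b) ⟨⟨abs_le.1 ha, abs_le.1 hb⟩, h⟩
      have h4 : 2 ^ p = 2 ^ p / δ * δ := by field_simp
      have h5 := mul_le_mul_of_nonneg_left h3 hC
      have h6 : 0 ≤ ε * (|a| ^ p + |b| ^ p) := by positivity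
      simp only at h5
      linarith
    · have h2 := mul_le_mul_of_nonneg_left h1 hε.le
      have h3 := mul_nonneg hC hD
      linarith
  intro a b
  rcases (le_max_of_le_left (abs_nonneg a) : 0 ≤ max |a| |b|).eq_or_lt with h0 | h0
  · have ha : a = 0 := abs_nonpos_iff.1 (h0 ▸ le_max_left _ _)
    have hb : b = 0 := abs_nonpos_iff.1 (h0 ▸ le_max_right _ _)
    subst ha hb
    simp [Real.zero_rpow (by linarith : p ≠ 0)]
  · set m := max |a| |b| with hm
    -- Both sides are homogeneous of degree p, so division by max(|a|, |b|) reduces to the unit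
    -- square.
    have scale : ∀ x : ℝ, |x| ^ p = m ^ p * |x / m| ^ p := by
      intro x
      rw [abs_div, abs_of_pos h0, Real.div_rpow (abs_nonneg x) h0.le,
        mul_div_cancel₀ _ (Real.rpow_pos_of_pos h0 p).ne']
    have key := unit (a / m) (b / m)
      (by rw [abs_div, abs_of_pos h0]; exact div_le_one_of_le₀ (le_max_left _ _) h0.le)
      (by rw [abs_div, abs_of_pos h0]; exact div_le_one_of_le₀ (le_max_right _ _) h0.le)
      (by
        have e1 := Real.rpow_nonneg (abs_nonneg (a / m)) p
        have e2 := Real.rpow_nonneg (abs_nonneg (b / m)) p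
        rcases max_choice |a| |b| with h | h
        · have : |a / m| = 1 := by rw [abs_div, abs_of_pos h0, hm, h, div_self]; rw [← h]; exact h0.ne'
          rw [this, Real.one_rpow]; linarith
        · have : |b / m| = 1 := by rw [abs_div, abs_of_pos h0, hm, h, div_self]; rw [← h]; exact h0.ne'
          rw [this, Real.one_rpow]; linarith)
    have := mul_le_mul_of_nonneg_left key (Real.rpow_nonneg h0.le p)
    rw [scale a, scale b, scale (a - b), scale ((a + b) / 2)]
    rw [show (a - b) / m = a / m - b / m by ring, show (a + b) / 2 / m = (a / m + b / m) / 2 by ring]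
    linarith

/-- A substitute for Hölder's inequality: since 1 - p < 0, large K makes the coefficient of |x|^p as
small as desired. -/
theorem abs_le_add_rpow (hp : 1 < p) {K : ℝ} (hK : 0 < K) (x : ℝ) :
    |x| ≤ K + K ^ (1 - p) * |x| ^ p := by
  have h0 : 0 ≤ K ^ (1 - p) * |x| ^ p := by positivity
  rcases le_total |x| K with h | h
  · linarith
  · have hx : 0 < |x| := hK.trans_le h
    have h1 : |x| = |x| ^ (1 - p) * |x| ^ p := by
      rw [← Real.rpow_add hx]; simp
    have h2 : |x| ^ (1 - p) ≤ K ^ (1 - p) :=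
      Real.rpow_le_rpow_of_nonpos hK h (by linarith)
    have h3 := mul_le_mul_of_nonneg_right h2 (Real.rpow_nonneg hx.le p)
    linarith

end Pointwise

/-! ### Completeness of L^p and estimates for primitives. -/

section Lp

variable {α : Type*} [MeasurableSpace α] {μ : Measure α} {p : ℝ}

theorem norm_toLp_rpow (hp : 1 < p) {f : α → ℝ} (hf : MemLp f (ENNReal.ofReal p) μ) :
    ‖hf.toLp f‖ ^ p = ∫ x, |f x| ^ p ∂μ := by
  have hp0 : 0 < p := by linarith
  have h0 : 0 ≤ ∫ x, |f x| ^ p ∂μ := integral_nonneg fun _ => Real.rpow_nonneg (abs_nonneg _) _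
  rw [Lp.norm_toLp, hf.eLpNorm_eq_integral_rpow_norm (by simpa using hp0) (by simp),
    ENNReal.toReal_ofReal hp0.le, ENNReal.toReal_ofReal (Real.rpow_nonneg (by simpa using h0) _),
    Real.rpow_inv_rpow (by simpa using h0) hp0.ne']
  rfl

/-- Completeness of `L^p`, in terms of integrals. -/
theorem exists_limit_of_cauchy_rpow (hp : 1 < p) {g : ℕ → α → ℝ}
    (hg : ∀ n, MemLp (g n) (ENNReal.ofReal p) μ)
    (hC : ∀ ε > 0, ∃ N, ∀ m ≥ N, ∀ n ≥ N, ∫ x, |g m x - g n x| ^ p ∂μ < ε) :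
    ∃ G, MemLp G (ENNReal.ofReal p) μ ∧
      Tendsto (fun n => ∫ x, |g n x - G x| ^ p ∂μ) atTop (𝓝 0) ∧
      Tendsto (fun n => ∫ x, |g n x| ^ p ∂μ) atTop (𝓝 (∫ x, |G x| ^ p ∂μ)) := by
  have hp0 : 0 < p := by linarith
  have : Fact (1 ≤ ENNReal.ofReal p) := ⟨by rw [ENNReal.one_le_ofReal]; exact hp.le⟩
  have hdist : ∀ {a b : α → ℝ} (ha : MemLp a (ENNReal.ofReal p) μ)
      (hb : MemLp b (ENNReal.ofReal p) μ),
      dist (ha.toLp a) (hb.toLp b) ^ p = ∫ x, |a x - b x| ^ p ∂μ := by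
    intro a b ha hb
    rw [dist_eq_norm, ← MemLp.toLp_sub, norm_toLp_rpow hp (ha.sub hb)]
    rfl
  have hcs : CauchySeq fun n => (hg n).toLp (g n) := by
    rw [Metric.cauchySeq_iff]
    intro ε hε
    obtain ⟨N, hN⟩ := hC (ε ^ p) (Real.rpow_pos_of_pos hε p)
    refine ⟨N, fun m hm n hn => ?_⟩
    have := hN m hm n hn
    rw [← hdist (hg m) (hg n)] at this
    exact (Real.rpow_lt_rpow_iff dist_nonneg hε.le hp0).1 this
  obtain ⟨L, hL⟩ := cauchySeq_tendsto_of_complete hcs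
  have hLm := Lp.memLp L
  have eL : hLm.toLp L = L := Lp.toLp_coeFn L hLm
  refine ⟨L, hLm, ?_, ?_⟩
  · have h1 : Tendsto (fun n => dist ((hg n).toLp (g n)) (hLm.toLp L) ^ p) atTop (𝓝 0) := by
      rw [eL]
      have := (tendsto_iff_dist_tendsto_zero.1 hL).rpow_const (p := p) (Or.inr hp0.le)
      rwa [Real.zero_rpow hp0.ne'] at this
    simpa only [hdist] using h1
  · have h1 := hL.norm.rpow_const (p := p) (Or.inr hp0.le)
    rw [← eL] at h1
    simp only [norm_toLp_rpow hp] at h1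
    exact h1

theorem abs_intervalIntegral_le (hp : 1 < p) {l K x y : ℝ} {f : ℝ → ℝ} (hK : 0 < K)
    (hf : MemLp f (ENNReal.ofReal p) (volume.restrict (Ioo 0 l)))
    (hx : 0 ≤ x) (hxy : x ≤ y) (hy : y ≤ l) :
    |∫ t in x..y, f t| ≤ K * (y - x) + K ^ (1 - p) * ∫ t in Ioo 0 l, |f t| ^ p := by
  have hsub : Ioo x y ⊆ Ioo 0 l := Ioo_subset_Ioo hx hy
  have i1 : IntegrableOn (fun t => |f t| ^ p) (Ioo 0 l) := hf.integrable_abs_rpow hp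
  have i2 : IntegrableOn f (Ioo x y) := (hf.integrableOn_Ioo hp).mono_set hsub
  rw [intervalIntegral.integral_of_le hxy, integral_Ioc_eq_integral_Ioo]
  calc |∫ t in Ioo x y, f t| ≤ ∫ t in Ioo x y, |f t| := abs_integral_le_integral_abs
    _ ≤ ∫ t in Ioo x y, (K + K ^ (1 - p) * |f t| ^ p) := by
        refine integral_mono i2.abs ?_ fun t => abs_le_add_rpow hp hK (f t)
        exact (integrable_const _).add ((i1.mono_set hsub).const_mul _)
    _ = K * (y - x) + K ^ (1 - p) * ∫ t in Ioo x y, |f t| ^ p := by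
        rw [integral_add (integrable_const _) ((i1.mono_set hsub).const_mul _),
          integral_const_mul, setIntegral_const, Real.volume_real_Ioo_of_le hxy, smul_eq_mul,
          mul_comm]
    _ ≤ _ := by
        gcongr
        · exact Eventually.of_forall fun _ => Real.rpow_nonneg (abs_nonneg _) _

end Lp

theorem IsPrim.abs_sub_le {p l : ℝ} (hp : 1 < p) (hl : 0 < l) {u g : ℝ → ℝ}
    (hu : IsPrim p l u g) {K : ℝ} (hK : 0 < K) {x y : ℝ} (hx : x ∈ Icc 0 l) (hy : y ∈ Icc 0 l) :
    |u x - u y| ≤ K * |x - y| + K ^ (1 - p) * ∫ t in Ioo 0 l, |g t| ^ p := by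
  wlog hxy : y ≤ x generalizing x y
  · rw [abs_sub_comm, abs_sub_comm x]
    exact this hy hx (le_of_not_ge hxy)
  have e : u x - u y = ∫ t in y..x, g t := by
    rw [hu.2 x hx, hu.2 y hy, ← intervalIntegral.integral_interval_sub_left
      (hu.intervalIntegrable_of_mem hp hl hx) (hu.intervalIntegrable_of_mem hp hl hy)]
    ring
  rw [e, abs_of_nonneg (sub_nonneg.2 hxy)]
  exact abs_intervalIntegral_le hp hK hu.1 hy.1 hxy hx.2

/-! ### Compactness and existence of a minimizer. -/

namespace MetricGraph

variable {V E : Type*} {Γ : MetricGraph V E} {p : ℝ} {VD : Set V}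

/-- Bounded sequences in `W^{1,p}` of the graph have uniformly convergent subsequences. -/
theorem exists_uniform_subseq [Finite E] (hp : 1 < p) {u g : ℕ → E → ℝ → ℝ}
    (hu : ∀ n, Γ.IsGPrim p VD (u n) (g n))
    (hb : ∀ n e, ∀ x ∈ Icc 0 (Γ.length e), |u n e x| ≤ 1) {A : ℝ}
    (hA : ∀ n e, ∫ x in Ioo 0 (Γ.length e), |g n e x| ^ p ≤ A) :
    ∃ φ : ℕ → ℕ, StrictMono φ ∧ ∃ U : E → ℝ → ℝ, ∀ ε > 0, ∀ᶠ n in atTop,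
      ∀ e, ∀ x ∈ Icc 0 (Γ.length e), |u (φ n) e x - U e x| < ε := by
  classical
  -- Arzelà-Ascoli on the disjoint union of the closed edges; the gluing at vertices is recovered in
  -- the limit.
  let F : ℕ → BoundedContinuousFunction (Σ e, Icc 0 (Γ.length e)) ℝ := fun n =>
    BoundedContinuousFunction.mkOfCompact ⟨fun z => u n z.1 z.2,
      continuous_sigma fun e => ((hu n).continuousOn hp e).domRestrict⟩
  have hcomp : IsCompact (closure (range F)) := by
    refine BoundedContinuousFunction.arzela_ascoli (Icc (-1) 1) isCompact_Icc _ ?_ ?_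
    · rintro _ ⟨e, x, hx⟩ ⟨n, rfl⟩
      exact abs_le.1 (hb n e x hx)
    · rintro ⟨e, x, hx⟩
      rw [Metric.equicontinuousAt_iff_right]
      intro ε hε
      have h1 : Tendsto (fun K : ℝ => K ^ (1 - p) * A) atTop (𝓝 0) := by
        have := (tendsto_rpow_neg_atTop (sub_pos.2 hp)).mul_const A
        simpa using this
      obtain ⟨K, hK, hK0⟩ := ((h1.eventually_lt_const (half_pos hε)).and
        (eventually_gt_atTop (0 : ℝ))).exists
      rw [Sigma.nhds_mk, eventually_map]
      filter_upwards [Metric.ball_mem_nhds (⟨x, hx⟩ : Icc 0 (Γ.length e))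
        (show 0 < ε / 2 / K by positivity)] with y hy
      rintro ⟨_, n, rfl⟩
      rw [Metric.mem_ball, dist_comm, Subtype.dist_eq, Real.dist_eq, lt_div_iff₀ hK0] at hy
      have h2 := ((hu n).1 e).abs_sub_le hp (Γ.length_pos e) hK0 hx y.2
      have h3 := mul_le_mul_of_nonneg_left (hA n e) (Real.rpow_nonneg hK0.le (1 - p))
      change |u n e x - u n e y| < ε
      simp only at hy
      linarith
  obtain ⟨L, -, φ, hφ, hL⟩ := hcomp.tendsto_subseq fun n => subset_closure (mem_range_self n)
  rw [BoundedContinuousFunction.tendsto_iff_tendstoUniformly, Metric.tendstoUniformly_iff] at hL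
  refine ⟨φ, hφ, fun e x => if hx : x ∈ Icc 0 (Γ.length e) then L ⟨e, x, hx⟩ else 0,
    fun ε hε => ?_⟩
  filter_upwards [hL ε hε] with n hn e x hx
  rw [dif_pos hx, abs_sub_comm]
  exact hn ⟨e, x, hx⟩

variable [Fintype E]

/-- Dominated convergence with bound 1. A general filter is needed because it also serves midpoints
indexed by pairs. -/
theorem tendsto_powerNorm_of_tendsto (hp : 1 < p) {ι : Type*} {F : Filter ι}
    [F.IsCountablyGenerated] {w : ι → E → ℝ → ℝ} {U : E → ℝ → ℝ}
    (hc : ∀ i e, ContinuousOn (w i e) (Icc 0 (Γ.length e)))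
    (hb : ∀ i e, ∀ x ∈ Icc 0 (Γ.length e), |w i e x| ≤ 1)
    (hw : ∀ e, ∀ x ∈ Icc 0 (Γ.length e), Tendsto (fun i => w i e x) F (𝓝 (U e x))) :
    Tendsto (fun i => Γ.powerNorm p (w i)) F (𝓝 (Γ.powerNorm p U)) := by
  refine tendsto_finsetSum _ fun e _ => tendsto_integral_filter_of_dominated_convergence
    (fun _ => 1) (Eventually.of_forall fun i => ?_) (Eventually.of_forall fun i => ?_)
    (integrable_const _) ?_
  · exact ((hc i e).memLp_Ioo.integrable_abs_rpow hp).aestronglyMeasurable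
  · filter_upwards [ae_restrict_mem measurableSet_Ioo] with x hx
    rw [Real.norm_eq_abs, abs_of_nonneg (Real.rpow_nonneg (abs_nonneg _) _)]
    exact Real.rpow_le_one (abs_nonneg _) (hb i e x (Ioo_subset_Icc_self hx)) (by linarith)
  · filter_upwards [ae_restrict_mem measurableSet_Ioo] with x hx
    exact (hw e x (Ioo_subset_Icc_self hx)).abs.rpow_const (Or.inr (by linarith))

theorem setIntegral_le_powerNorm (g : E → ℝ → ℝ) (e : E) :
    ∫ x in Ioo 0 (Γ.length e), |g e x| ^ p ≤ Γ.powerNorm p g :=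
  Finset.single_le_sum (f := fun e => ∫ x in Ioo 0 (Γ.length e), |g e x| ^ p)
    (fun _ _ => integral_nonneg fun _ => Real.rpow_nonneg (abs_nonneg _) _) (Finset.mem_univ e)

/-- Integrated form of the quantitative strict convexity. -/
theorem powerNorm_sub_le (hp : 1 < p) {ε C : ℝ}
    (hC : ∀ a b : ℝ, |a - b| ^ p ≤
      ε * (|a| ^ p + |b| ^ p) + C * ((|a| ^ p + |b| ^ p) / 2 - |(a + b) / 2| ^ p))
    {g h : E → ℝ → ℝ}
    (hg : ∀ e, MemLp (g e) (ENNReal.ofReal p) (volume.restrict (Ioo 0 (Γ.length e))))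
    (hh : ∀ e, MemLp (h e) (ENNReal.ofReal p) (volume.restrict (Ioo 0 (Γ.length e)))) :
    Γ.powerNorm p (fun e x => g e x - h e x) ≤
      ε * (Γ.powerNorm p g + Γ.powerNorm p h) +
        C * ((Γ.powerNorm p g + Γ.powerNorm p h) / 2 -
          Γ.powerNorm p fun e x => 2⁻¹ * (g e x + h e x)) := by
  simp only [powerNorm, integral, ← Finset.sum_add_distrib, Finset.sum_div,
    ← Finset.sum_sub_distrib, Finset.mul_sum]
  refine Finset.sum_le_sum fun e _ => ?_
  have i1 := (hg e).integrable_abs_rpow hp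
  have i2 := (hh e).integrable_abs_rpow hp
  have i3 : IntegrableOn (fun x => |2⁻¹ * (g e x + h e x)| ^ p) (Ioo 0 (Γ.length e)) :=
    (((hg e).add (hh e)).const_mul 2⁻¹).integrable_abs_rpow hp
  have i4 : IntegrableOn (fun x => |g e x - h e x| ^ p) (Ioo 0 (Γ.length e)) :=
    ((hg e).sub (hh e)).integrable_abs_rpow hp
  have i5 : Integrable (fun x => |g e x| ^ p + |h e x| ^ p)
    (volume.restrict (Ioo 0 (Γ.length e))) := i1.add i2
  have i6 : Integrable (fun x => (|g e x| ^ p + |h e x| ^ p) / 2 - |2⁻¹ * (g e x + h e x)| ^ p)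
    (volume.restrict (Ioo 0 (Γ.length e))) := (i5.div_const 2).sub i3
  rw [← integral_add i1 i2, ← integral_const_mul, ← integral_div,
    ← integral_sub (i5.div_const 2) i3, ← integral_const_mul,
    ← integral_add (i5.const_mul ε) (i6.const_mul C)]
  refine integral_mono i4 ((i5.const_mul ε).add (i6.const_mul C)) fun x => ?_
  have := hC (g e x) (h e x)
  rw [show (g e x + h e x) / 2 = 2⁻¹ * (g e x + h e x) by ring] at this
  exact this

theorem IsNontrivial.exists_isMax {u : E → ℝ → ℝ}
    (hc : ∀ e, ContinuousOn (u e) (Icc 0 (Γ.length e))) (hn : Γ.IsNontrivial u) :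
    ∃ M, 0 < M ∧ (∀ e, ∀ x ∈ Icc 0 (Γ.length e), |u e x| ≤ M) ∧
      ∃ e, ∃ x ∈ Icc 0 (Γ.length e), |u e x| = M := by
  obtain ⟨e₁, x₁, hx₁, hne⟩ := hn
  have : Nonempty E := ⟨e₁⟩
  choose y hy hmax using fun e => isCompact_Icc.exists_isMaxOn
    (nonempty_Icc.2 (Γ.length_pos e).le) (hc e).abs
  obtain ⟨e₀, -, h₀⟩ := Finset.exists_max_image Finset.univ (fun e => |u e (y e)|)
    Finset.univ_nonempty
  have hle : ∀ e, ∀ x ∈ Icc 0 (Γ.length e), |u e x| ≤ |u e₀ (y e₀)| := fun e x hx =>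
    (hmax e hx).trans (h₀ e (Finset.mem_univ e))
  exact ⟨_, (abs_pos.2 hne).trans_le (hle e₁ x₁ hx₁), hle, e₀, y e₀, hy e₀, rfl⟩

/-- A minimizing sequence for the Rayleigh quotient, normalized in the supremum norm. -/
theorem exists_minimizing_seq [Nonempty E] (hp : 1 < p) (Γ : MetricGraph V E) (VD : Set V) :
    ∃ (u g : ℕ → E → ℝ → ℝ) (s : ℕ → ℝ), Antitone s ∧
      Tendsto s atTop (𝓝 (Γ.firstEigenvalue p VD)) ∧ ∀ n, 0 ≤ s n ∧
        Γ.IsGPrim p VD (u n) (g n) ∧ (∀ e, ∀ x ∈ Icc 0 (Γ.length e), |u n e x| ≤ 1) ∧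
        (∃ e, ∃ x ∈ Icc 0 (Γ.length e), |u n e x| = 1) ∧
        Γ.powerNorm p (g n) = s n * Γ.powerNorm p (u n) := by
  classical
  have hne : {r : ℝ | ∃ u : E → ℝ → ℝ, Γ.MemX p VD u ∧ Γ.IsNontrivial u ∧
      r = Γ.integral (fun e x => |Γ.edgeDeriv u e x| ^ p) /
        Γ.integral (fun e x => |u e x| ^ p)}.Nonempty := by
    obtain ⟨e⟩ := ‹Nonempty E›
    have hl := Γ.length_pos e
    have hw : Γ.IsGPrim p VD (Pi.single e fun x => x * (Γ.length e - x))
        (Pi.single e fun x => Γ.length e - 2 * x) := by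
      refine IsGPrim.single e (fun x => ?_) (by fun_prop) (by simp) (by simp)
      exact ((hasDerivAt_id' x).fun_mul ((hasDerivAt_id' x).const_sub (Γ.length e))).congr_deriv
        (by ring)
    refine ⟨_, _, hw.memX hp, ⟨e, Γ.length e / 2, ⟨by linarith, by linarith⟩, ?_⟩, rfl⟩
    rw [Pi.single_eq_same]
    have : 0 < Γ.length e / 2 * (Γ.length e - Γ.length e / 2) :=
      mul_pos (by linarith) (by linarith)
    exact this.ne'
  have hbdd : ∀ r ∈ {r : ℝ | ∃ u : E → ℝ → ℝ, Γ.MemX p VD u ∧ Γ.IsNontrivial u ∧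
      r = Γ.integral (fun e x => |Γ.edgeDeriv u e x| ^ p) /
        Γ.integral (fun e x => |u e x| ^ p)}, 0 ≤ r := by
    rintro _ ⟨u, -, -, rfl⟩
    exact div_nonneg (powerNorm_nonneg _) (powerNorm_nonneg _)
  obtain ⟨s, hs, hlim, hmem⟩ := exists_seq_tendsto_sInf hne ⟨0, hbdd⟩
  have key : ∀ n, ∃ u g, Γ.IsGPrim p VD u g ∧ (∀ e, ∀ x ∈ Icc 0 (Γ.length e), |u e x| ≤ 1) ∧
      (∃ e, ∃ x ∈ Icc 0 (Γ.length e), |u e x| = 1) ∧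
      Γ.powerNorm p g = s n * Γ.powerNorm p u := by
    intro n
    obtain ⟨u, hu, hnt, hr⟩ := hmem n
    have hG := hu.isGPrim hp
    -- Division by the maximum M of |u| preserves the quotient; supremum norm 1 keeps a uniform
    -- limit nonzero.
    obtain ⟨M, hM, hle, e, x, hx, heq⟩ := hnt.exists_isMax (hG.continuousOn hp)
    have hab : ∀ e x, |M⁻¹ * u e x| = |u e x| / M := fun e x => by
      rw [abs_mul, abs_of_pos (inv_pos.2 hM), inv_mul_eq_div]
    refine ⟨_, _, hG.const_mul M⁻¹, fun e x hx => ?_, ⟨e, x, hx, ?_⟩, ?_⟩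
    · rw [hab]
      exact div_le_one_of_le₀ (hle e x hx) hM.le
    · rw [hab, heq, div_self hM.ne']
    · rw [powerNorm_const_mul, powerNorm_const_mul]
      have h1 : s n * Γ.powerNorm p u = Γ.powerNorm p (Γ.edgeDeriv u) := by
        rw [hr]
        exact div_mul_cancel₀ _ (hG.powerNorm_pos hp hnt).ne'
      rw [← h1]
      ring
  choose u g h1 h2 h3 h4 using key
  exact ⟨u, g, s, hs, hlim, fun n => ⟨hbdd _ (hmem n), h1 n, h2 n, h3 n, h4 n⟩⟩

/-- The Rayleigh quotient has a minimizer. -/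
theorem exists_isEigenfunction [Nonempty E] (hp : 1 < p) (Γ : MetricGraph V E) (VD : Set V) :
    ∃ u, Γ.IsEigenfunction p VD (Γ.firstEigenvalue p VD) u := by
  obtain ⟨u, g, s, hs, hlim, H⟩ := exists_minimizing_seq hp Γ VD
  have hL : ∀ n, Γ.powerNorm p (u n) ≤ ∑ e, Γ.length e := by
    intro n
    refine Finset.sum_le_sum fun e _ => ?_
    calc ∫ x in Ioo 0 (Γ.length e), |u n e x| ^ p ≤ ∫ x in Ioo 0 (Γ.length e), 1 := by
          refine setIntegral_mono_on ((H n).2.1.integrableOn_abs_rpow hp e)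
            (integrableOn_const (by simp)) measurableSet_Ioo fun x hx => ?_
          exact Real.rpow_le_one (abs_nonneg _) ((H n).2.2.1 e x (Ioo_subset_Icc_self hx))
            (by linarith)
      _ = Γ.length e := by
          simp [Real.volume_real_Ioo_of_le (Γ.length_pos e).le]
  have hA : ∀ n, Γ.powerNorm p (g n) ≤ s 0 * ∑ e, Γ.length e := fun n => by
    rw [(H n).2.2.2.2]
    exact mul_le_mul (hs (Nat.zero_le n)) (hL n) (powerNorm_nonneg _) (H 0).1
  obtain ⟨φ, hφ, U, hU⟩ := exists_uniform_subseq hp (fun n => (H n).2.1) (fun n => (H n).2.2.1)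
    (fun n e => (setIntegral_le_powerNorm (g n) e).trans (hA n))
  have hpt : ∀ e, ∀ x ∈ Icc 0 (Γ.length e), Tendsto (fun n => u (φ n) e x) atTop (𝓝 (U e x)) := by
    intro e x hx
    rw [Metric.tendsto_atTop']
    intro ε hε
    obtain ⟨N, hN⟩ := eventually_atTop.1 (hU ε hε)
    exact ⟨N, fun n hn => hN n hn.le e x hx⟩
  set lam := Γ.firstEigenvalue p VD with hlam
  set β := Γ.powerNorm p U with hβ
  have hB : Tendsto (fun n => Γ.powerNorm p (u (φ n))) atTop (𝓝 β) :=
    tendsto_powerNorm_of_tendsto hp (fun n e => (H _).2.1.continuousOn hp e)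
      (fun n => (H _).2.2.1) hpt
  have hg : Tendsto (fun n => Γ.powerNorm p (g (φ n))) atTop (𝓝 (lam * β)) := by
    simp only [(H _).2.2.2.2]
    exact (hlim.comp hφ.tendsto_atTop).mul hB
  have hmid : Tendsto (fun q : ℕ × ℕ => Γ.powerNorm p
      fun e x => 2⁻¹ * (u (φ q.1) e x + u (φ q.2) e x)) (atTop ×ˢ atTop) (𝓝 β) := by
    refine tendsto_powerNorm_of_tendsto hp (fun q e => ?_) (fun q e x hx => ?_) fun e x hx => ?_
    · exact (((H _).2.1.add hp (H _).2.1).const_mul 2⁻¹).continuousOn hp e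
    · rw [abs_mul, abs_of_pos (by norm_num : (0 : ℝ) < 2⁻¹)]
      have h1 := (H (φ q.1)).2.2.1 e x hx
      have h2 := (H (φ q.2)).2.2.1 e x hx
      have h3 := abs_add_le (u (φ q.1) e x) (u (φ q.2) e x)
      linarith
    · have h1 := ((hpt e x hx).comp (tendsto_fst (f := atTop) (g := atTop))).add ((hpt e x hx).comp tendsto_snd)
      replace h1 := h1.const_mul (2 : ℝ)⁻¹
      rw [show (2 : ℝ)⁻¹ * (U e x + U e x) = U e x by ring] at h1
      exact h1
  -- The mean energy of two members exceeds λ₁N of their midpoint by a quantity tending to 0, since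
  -- both functions and midpoints converge to U.
  have hgap : Tendsto (fun q : ℕ × ℕ => (Γ.powerNorm p (g (φ q.1)) + Γ.powerNorm p (g (φ q.2))) / 2
      - lam * Γ.powerNorm p fun e x => 2⁻¹ * (u (φ q.1) e x + u (φ q.2) e x))
      (atTop ×ˢ atTop) (𝓝 0) := by
    have := (((hg.comp tendsto_fst).add (hg.comp tendsto_snd)).div_const 2).sub
      (hmid.const_mul lam)
    rw [show (lam * β + lam * β) / 2 - lam * β = 0 by ring] at this
    exact this
  set A := s 0 * ∑ e, Γ.length e with hAdef
  have hA0 : 0 ≤ A := (powerNorm_nonneg _).trans (hA 0)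
  have hcauchy : ∀ ε > 0, ∃ N, ∀ m ≥ N, ∀ n ≥ N,
      Γ.powerNorm p (fun e x => g (φ m) e x - g (φ n) e x) < ε := by
    intro ε hε
    -- Two energies sum to at most 2A, so the ε-term stays below ε/2; the +1 avoids division by
    -- zero.
    obtain ⟨C, hC0, hC⟩ := exists_abs_sub_rpow_le hp (show 0 < ε / 2 / (2 * A + 1) by positivity)
    have h1 := hgap.const_mul C
    rw [mul_zero] at h1
    have h2 := h1.eventually_lt_const (half_pos hε)
    rw [prod_atTop_atTop_eq, eventually_atTop] at h2
    obtain ⟨⟨N₁, N₂⟩, hN⟩ := h2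
    refine ⟨max N₁ N₂, fun m hm n hn => ?_⟩
    have h3 := hN (m, n) ⟨le_of_max_le_left hm, le_of_max_le_right hn⟩
    have h4 := powerNorm_sub_le (Γ := Γ) hp hC (fun e => ((H (φ m)).2.1.1 e).1)
      (fun e => ((H (φ n)).2.1.1 e).1)
    have h5 := (((H (φ m)).2.1.add hp (H (φ n)).2.1).const_mul 2⁻¹).firstEigenvalue_mul_le hp
    have h6 : ε / 2 / (2 * A + 1) * (Γ.powerNorm p (g (φ m)) + Γ.powerNorm p (g (φ n))) ≤ ε / 2 := by
      rw [div_mul_eq_mul_div, div_le_iff₀ (by positivity)]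
      refine mul_le_mul_of_nonneg_left ?_ (half_pos hε).le
      linarith [hA (φ m), hA (φ n)]
    have h7 := mul_le_mul_of_nonneg_left (sub_le_sub_left h5
      ((Γ.powerNorm p (g (φ m)) + Γ.powerNorm p (g (φ n))) / 2)) hC0
    simp only at h3
    linarith
  have hlimit := fun e => exists_limit_of_cauchy_rpow hp
    (μ := volume.restrict (Ioo 0 (Γ.length e))) (g := fun n => g (φ n) e)
    (fun n => ((H (φ n)).2.1.1 e).1) (fun ε hε => by
      obtain ⟨N, hN⟩ := hcauchy ε hε
      exact ⟨N, fun m hm n hn => (setIntegral_le_powerNorm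
        (fun e x => g (φ m) e x - g (φ n) e x) e).trans_lt (hN m hm n hn)⟩)
  choose G hG hG0 hG1 using hlimit
  have hGn : Γ.powerNorm p G = lam * β :=
    tendsto_nhds_unique (tendsto_finsetSum _ fun e _ => hG1 e) hg
  have hprim : Γ.IsGPrim p VD U G := by
    refine ⟨fun e => ⟨hG e, fun x hx => ?_⟩, ?_⟩
    · have hl := Γ.length_pos e
      have h0 := hpt e 0 (left_mem_Icc.2 hl.le)
      have hint : Tendsto (fun n => ∫ t in (0 : ℝ)..x, g (φ n) e t) atTop
          (𝓝 (∫ t in (0 : ℝ)..x, G e t)) := by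
        rw [Metric.tendsto_atTop']
        intro ε hε
        set K := ε / 2 / (x + 1) with hK
        have hx1 : 0 < x + 1 := by linarith [hx.1]
        have hK0 : 0 < K := by positivity
        have h1 := (hG0 e).const_mul (K ^ (1 - p))
        rw [mul_zero] at h1
        obtain ⟨N, hN⟩ := eventually_atTop.1 (h1.eventually_lt_const (half_pos hε))
        refine ⟨N, fun n hn => ?_⟩
        have hgm := ((H (φ n)).2.1.1 e).1
        have hi : ∀ {f : ℝ → ℝ}, MemLp f (ENNReal.ofReal p) (volume.restrict
            (Ioo 0 (Γ.length e))) → IntervalIntegrable f volume 0 x := fun hf =>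
          (hf.intervalIntegrable_Ioo hp hl.le).mono_set (by
            rw [uIcc_of_le hl.le, uIcc_of_le hx.1]; exact Icc_subset_Icc_right hx.2)
        rw [Real.dist_eq, ← intervalIntegral.integral_sub (hi hgm) (hi (hG e))]
        have h2 := abs_intervalIntegral_le hp hK0 (hgm.sub (hG e)) le_rfl hx.1 hx.2
        have h3 := hN n hn.le
        have h4 : K * (x - 0) ≤ ε / 2 := by
          rw [hK, div_mul_eq_mul_div, div_le_iff₀ hx1]
          exact mul_le_mul_of_nonneg_left (by linarith) (half_pos hε).le
        simp only [Pi.sub_apply] at h2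
        linarith
      refine tendsto_nhds_unique (hpt e x hx) ?_
      refine (h0.add hint).congr fun n => ?_
      exact (((H (φ n)).2.1.1 e).2 x hx).symm
    · choose f hf hz using fun n => (H (φ n)).2.1.2
      -- At a vertex with an incident edge the limit exists by pointwise convergence on that edge;
      -- on `VD` the sequence is constantly 0.
      refine ⟨fun a => limUnder atTop fun n => f n a, fun e => ⟨?_, ?_⟩, fun a ha => ?_⟩
      · refine (Tendsto.limUnder_eq ?_).symm
        refine (hpt e 0 (left_mem_Icc.2 (Γ.length_pos e).le)).congr fun n => (hf n e).1
      · refine (Tendsto.limUnder_eq ?_).symm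
        refine (hpt e _ (right_mem_Icc.2 (Γ.length_pos e).le)).congr fun n => (hf n e).2
      · refine Tendsto.limUnder_eq ?_
        exact tendsto_const_nhds.congr fun n => (hz n a ha).symm
  have hnt : Γ.IsNontrivial U := by
    obtain ⟨n, hn⟩ := (hU 1 one_pos).exists
    obtain ⟨e, x, hx, h1⟩ := (H (φ n)).2.2.2.1
    refine ⟨e, x, hx, fun h0 => ?_⟩
    have := hn e x hx
    rw [h0, sub_zero, h1] at this
    exact lt_irrefl _ this
  exact ⟨U, hprim.isEigenfunction hp hnt hGn⟩

end MetricGraph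

theorem mainTheorem7 {V E : Type*} [Finite V] [Fintype E] (Γ : MetricGraph V E)
    (hconn : Γ.Connected) (p : ℝ) (hp : 1 < p) (VD : Set V) (hne : VD.Nonempty)
    (hterm : ∀ v ∈ VD, Γ.IsTerminal v)
    (hdeg : VD = Set.univ → Fintype.card E = 1) :
    (∀ u : E → ℝ → ℝ, Γ.IsEigenfunction p VD (Γ.firstEigenvalue p VD) u →
      (∀ e, ∀ x ∈ Set.Icc 0 (Γ.length e), ¬ Γ.IsVertexIn VD e x → 0 < u e x) ∨
      (∀ e, ∀ x ∈ Set.Icc 0 (Γ.length e), ¬ Γ.IsVertexIn VD e x → u e x < 0)) ∧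
    Γ.IsSimpleEigenvalue p VD (Γ.firstEigenvalue p VD) := by
  obtain ⟨v, hv⟩ := hne
  -- A terminal vertex has a neighbour, hence an edge exists, as the existence of a minimizer
  -- requires.
  obtain ⟨-, ⟨e, -⟩, -⟩ := hterm v hv
  have : Nonempty E := ⟨e⟩
  refine ⟨fun u hu => ?_, MetricGraph.exists_isEigenfunction hp Γ VD,
    fun u v hu hv => hu.eq_const_mul hconn hp hterm hdeg hv⟩
  exact (hu.pos_or_neg hconn hp hterm hdeg).imp (fun h e x hx hxv => h e x ⟨hx, hxv⟩)
    (fun h e x hx hxv => h e x ⟨hx, hxv⟩)
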